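/- **Setting.** Let $(M,g,J)$ be a Kähler manifold of real dimension $2n$, $n\ge 2$, and let $D$ be a smooth $J$-invariant distribution on $M$ of real codimension two. If $\xi$ is a unit vector orthogonal to $D$ at a point, then $D^\perp=\mathrm{span}\{\xi,J\xi\}$ there; put $\eta=g(\xi,\cdot)$ and $\tilde\eta=g(J\xi,\cdot)$. Let $\bar R(X,Y)Z=\bar\nabla_X\bar\nabla_YZ-\bar\nabla_Y\bar\nabla_XZ-\bar\nabla_{[X,Y]}Z$ be the curvature of the Levi-Civita connection $\bar\nabla$ of $g$, and $\bar R(X,Y,Z,U)=g(\bar R(X,Y)Z,U)$. Assume that $(M,g,J,D)$ is of quasi-constant holomorphic sectional curvatures (a Kähler QCH-manifold): for a unit vector $X\in T_xM$ the number $\bar R(X,JX,JX,X)$ depends only on the point $x$ and on the angle $\varphi\in[0,\frac{\pi}{2}]$ between $\mathrm{span}\{X,JX\}$ and $D^\perp$, where $\cos\varphi=\sqrt{\eta(X)^2+\tilde\eta(X)^2}$. Let $a,b,c:M\to\mathbb R$ be functions with $$\bar R=a\,\pi+b\,\Phi+c\,\Psi ,$$ where $$\begin{aligned}4\pi(X,Y,Z,U)={}&g(Y,Z)g(X,U)-g(X,Z)g(Y,U)+g(JY,Z)g(JX,U)\\&-g(JX,Z)g(JY,U)-2g(JX,Y)g(JZ,U),\end{aligned}$$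 $$\begin{aligned}8\Phi(X,Y,Z,U)={}&g(Y,Z)\{\eta(X)\eta(U)+\tilde\eta(X)\tilde\eta(U)\}-g(X,Z)\{\eta(Y)\eta(U)+\tilde\eta(Y)\tilde\eta(U)\}\\ &+g(X,U)\{\eta(Y)\eta(Z)+\tilde\eta(Y)\tilde\eta(Z)\}-g(Y,U)\{\eta(X)\eta(Z)+\tilde\eta(X)\tilde\eta(Z)\}\\ &+g(JY,Z)\{\eta(X)\tilde\eta(U)-\eta(U)\tilde\eta(X)\}-g(JX,Z)\{\eta(Y)\tilde\eta(U)-\eta(U)\tilde\eta(Y)\}\\ &+g(JX,U)\{\eta(Y)\tilde\eta(Z)-\eta(Z)\tilde\eta(Y)\}-g(JY,U)\{\eta(X)\tilde\eta(Z)-\eta(Z)\tilde\eta(X)\}\\ &-2g(JX,Y)\{\eta(Z)\tilde\eta(U)-\eta(U)\tilde\eta(Z)\}-2g(JZ,U)\{\eta(X)\tilde\eta(Y)-\eta(Y)\tilde\eta(X)\},\end{aligned}$$ $$\begin{aligned}\Psi(X,Y,Z,U)={}&\eta(Y)\eta(Z)\tilde\eta(X)\tilde\eta(U)-\eta(X)\eta(Z)\tilde\eta(Y)\tilde\eta(U)\\&+\eta(X)\eta(U)\tilde\eta(Y)\tilde\eta(Z)-\eta(Y)\eta(U)\tilde\eta(X)\tilde\eta(Z)\end{aligned}$$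 (these tensors do not depend on the choice of $\xi$). Let $N$ be an (immersed) Lagrangian submanifold of $M$: $\dim N=n$, and $J$ maps each tangent space of $N$ into the corresponding normal space. Give $N$ the induced metric, let $h$ be its second fundamental form and $H=\frac1n\sum_{i=1}^n h(e_i,e_i)$ its mean curvature vector, and let $\mathrm{Ric}(X)=\sum_{i=2}^n K(e_1\wedge e_i)$ be the Ricci curvature of $N$ at a unit vector $X=e_1$, where $e_1,\dots,e_n$ is an orthonormal basis of $T_pN$ and $K$ is the sectional curvature of $N$. Let $\eta^\top,\tilde\eta^\top$ be the tangential components of $\eta,\tilde\eta$, i.e. (identifying forms with vectors by $g$) the orthogonal projections of $\xi$ and $J\xi$ to $T_pN$. **Theorem.** Let $p\in N$. For every unit vector $X\in T_pN$, $$\mathrm{Ric}(X)\le \frac{n-1}{4}a+\frac18\{(n-2)[\eta(X)^2+\tilde\eta(X)^2]+1\}b+\|\eta(X)\tilde\eta^\top-\tilde\eta(X)\eta^\top\|^2c+\frac{(n-1)n}{4}\|H\|^2,$$ with $a,b,c$ evaluated at $p$. Equality holds for all unit vectors $X\in T_pN$ if and only if either (i) $p$ is a totally geodesic point, i.e. $h=0$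 at $p$; or (ii) $n=2$ and $p$ is an $H$-umbilical point with $\lambda=3\mu$. Here $p$ is called $H$-umbilical with the real numbers $\lambda,\mu$ if there is an orthonormal basis $e_1,\dots,e_n$ of $T_pN$ with $h(e_1,e_1)=\lambda Je_1$, $h(e_j,e_j)=\mu Je_1$, $h(e_1,e_j)=\mu Je_j$ for $j\ge2$, and $h(e_j,e_k)=0$ for $j\ne k$ with $j,k\ge 2$. -/

import Mathlib

set_option maxSynthPendingDepth 3

open scoped Manifold ContDiff Topology
open Bundle Set

namespace QCH

noncomputable section

/-! ## Riemannian geometry in a coordinate chart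

`G : E → E →L[ℝ] E →L[ℝ] ℝ` is the matrix field `(g_ij)` of a metric in a chart with values in the
model vector space `E`. -/

section Coordinates

variable {E : Type*} [NormedAddCommGroup E] [NormedSpace ℝ E]

/-- The cyclic permutation `(u, v, w) ↦ T w u v` of the arguments of a trilinear form. -/
def cycleForm (T : E →L[ℝ] E →L[ℝ] E →L[ℝ] ℝ) : E →L[ℝ] E →L[ℝ] E →L[ℝ] ℝ :=
  (ContinuousLinearMap.flipₗᵢ ℝ E E ℝ).toContinuousLinearEquiv.toContinuousLinearMap.comp T.flip

/-- The Christoffel symbols of the first kind: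
`(u, v, w) ↦ ½ (∂_u G(v, w) + ∂_v G(u, w) - ∂_w G(u, v))` at the point `y`. -/
def christoffelFirst (G : E → E →L[ℝ] E →L[ℝ] ℝ) (y : E) : E →L[ℝ] E →L[ℝ] E →L[ℝ] ℝ :=
  let T : E →L[ℝ] E →L[ℝ] E →L[ℝ] ℝ := fderiv ℝ G y
  let T' : E →L[ℝ] E →L[ℝ] E →L[ℝ] ℝ := T.flip
  let T'' : E →L[ℝ] E →L[ℝ] E →L[ℝ] ℝ := cycleForm T
  (1 / 2 : ℝ) • (T + T' - T'')

/-- The Christoffel symbols (of the second kind) of `G` at `y`, as a bilinear map `Γ(u, v)`: the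
index of `christoffelFirst` is raised with the inverse of `G y : E → E*`. -/
def christoffel (G : E → E →L[ℝ] E →L[ℝ] ℝ) (y : E) : E →L[ℝ] E →L[ℝ] E :=
  (ContinuousLinearMap.compL ℝ E (E →L[ℝ] ℝ) E (G y).inverse).comp (christoffelFirst G y)

/-- The coordinate expression of the curvature `R(u, v) w = ∇_u ∇_v w - ∇_v ∇_u w` (for constant
coordinate fields `u`, `v`, `w`, whose brackets vanish) of the Levi-Civita connection of `G`. -/
def curvatureCoord (G : E → E →L[ℝ] E →L[ℝ] ℝ) (y u v w : E) : E :=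
  fderiv ℝ (christoffel G) y u v w - fderiv ℝ (christoffel G) y v u w
    + christoffel G y u (christoffel G y v w) - christoffel G y v (christoffel G y u w)

end Coordinates

/-! ## Riemannian geometry on a manifold -/

section Pointwise

variable {V W : Type*} [AddCommGroup V] [Module ℝ V] [TopologicalSpace V]
  [IsTopologicalAddGroup V] [ContinuousConstSMul ℝ V]
  [AddCommGroup W] [Module ℝ W] [TopologicalSpace W]
  [IsTopologicalAddGroup W] [ContinuousConstSMul ℝ W]

/-- The pullback `(u, v) ↦ B (L u) (L v)` of a bilinear form along a linear map. -/
def pullbackForm (B : W →L[ℝ] W →L[ℝ] ℝ) (L : V →L[ℝ] W) : V →L[ℝ] V →L[ℝ] ℝ :=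
  (ContinuousLinearMap.precomp ℝ L).comp (B.comp L)

end Pointwise

/-- The trace `∑ g^{ij} T(b_i, b_j)` of a bilinear expression `T` with respect to an inner product
`g`, where `(g^{ij})` is the inverse of the Gram matrix of a basis `b`. For bilinear `T` it does not
depend on the basis, and it equals `∑ T(e_i, e_i)` for every `g`-orthonormal basis `e`. -/
def metricTrace {V W : Type*} [AddCommGroup V] [Module ℝ V] [FiniteDimensional ℝ V]
    [AddCommGroup W] [Module ℝ W] (g : V → V → ℝ) (T : V → V → W) : W :=
  let b := Module.finBasis ℝ V
  let gram : Matrix (Fin (Module.finrank ℝ V)) (Fin (Module.finrank ℝ V)) ℝ :=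
    Matrix.of fun i j => g (b i) (b j)
  ∑ i, ∑ j, gram⁻¹ i j • T (b i) (b j)

section Manifold

variable {E : Type*} [NormedAddCommGroup E] [NormedSpace ℝ E]
  {M : Type*} [TopologicalSpace M] [ChartedSpace E M]

instance tangentSpaceFiniteDimensional [FiniteDimensional ℝ E] (x : M) :
    FiniteDimensional ℝ (TangentSpace 𝓘(ℝ, E) x) :=
  inferInstanceAs (FiniteDimensional ℝ E)

variable [IsManifold 𝓘(ℝ, E) ∞ M]

/-- The coordinate frame at `q` of the chart around `p`: it sends a vector `(u^i)` of the model
space to the tangent vector `∑ u^i ∂_i` at `q`. -/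
def frameAt (p q : M) : E →L[ℝ] TangentSpace 𝓘(ℝ, E) q :=
  (trivializationAt E (TangentSpace 𝓘(ℝ, E)) p).symmL ℝ q

/-- The components, in the coordinate frame of the chart around `p`, of a tangent vector at `q`. -/
def coordsAt (p q : M) : TangentSpace 𝓘(ℝ, E) q →L[ℝ] E :=
  (trivializationAt E (TangentSpace 𝓘(ℝ, E)) p).continuousLinearMapAt ℝ q

/-- The components, as a function on the model space, of a field of bilinear forms in the chart
around `p`. -/
def metricCoord (g : ∀ x : M, TangentSpace 𝓘(ℝ, E) x →L[ℝ] TangentSpace 𝓘(ℝ, E) x →L[ℝ] ℝ)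
    (p : M) (y : E) : E →L[ℝ] E →L[ℝ] ℝ :=
  pullbackForm (g ((extChartAt 𝓘(ℝ, E) p).symm y))
    (frameAt p ((extChartAt 𝓘(ℝ, E) p).symm y))

/-- The Riemann curvature tensor `R(X, Y) Z` at `p` of a Riemannian metric `g`. -/
def curvature (g : ∀ x : M, TangentSpace 𝓘(ℝ, E) x →L[ℝ] TangentSpace 𝓘(ℝ, E) x →L[ℝ] ℝ)
    (p : M) (X Y Z : TangentSpace 𝓘(ℝ, E) p) : TangentSpace 𝓘(ℝ, E) p :=
  frameAt p p (curvatureCoord (metricCoord g p) (extChartAt 𝓘(ℝ, E) p p)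
    (coordsAt p p X) (coordsAt p p Y) (coordsAt p p Z))

/-- The Riemann curvature tensor `R(X, Y, Z, U) = g(R(X, Y) Z, U)` at `p`. -/
def riemann (g : ∀ x : M, TangentSpace 𝓘(ℝ, E) x →L[ℝ] TangentSpace 𝓘(ℝ, E) x →L[ℝ] ℝ)
    (p : M) (X Y Z U : TangentSpace 𝓘(ℝ, E) p) : ℝ :=
  g p (curvature g p X Y Z) U

/-- The Ricci curvature `Ric(X) = ∑ R(X, e_i, e_i, X)` of the Riemannian metric `g` at `p`, where
`e` is an orthonormal basis. For a unit vector `X = e_1` it is the sum of the sectional curvatures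
of the planes spanned by `e_1` and `e_i`, `i ≥ 2`. -/
def ricci [FiniteDimensional ℝ E]
    (g : ∀ x : M, TangentSpace 𝓘(ℝ, E) x →L[ℝ] TangentSpace 𝓘(ℝ, E) x →L[ℝ] ℝ)
    (p : M) (X : TangentSpace 𝓘(ℝ, E) p) : ℝ :=
  metricTrace (fun u v => g p u v) (fun u v => riemann g p X u v X)

/-! ## Kähler manifolds of quasi-constant holomorphic sectional curvatures -/

/-- The components of a field of endomorphisms in the chart around `p`. -/
def endoCoord (J : ∀ x : M, TangentSpace 𝓘(ℝ, E) x →L[ℝ] TangentSpace 𝓘(ℝ, E) x)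
    (p : M) (y : E) : E →L[ℝ] E :=
  (coordsAt p ((extChartAt 𝓘(ℝ, E) p).symm y)).comp
    ((J ((extChartAt 𝓘(ℝ, E) p).symm y)).comp (frameAt p ((extChartAt 𝓘(ℝ, E) p).symm y)))

/-- `(g, J)` is a Kähler structure: `J` is a smooth almost complex structure, `g` is Hermitian, and
`J` is parallel for the Levi-Civita connection of `g` (so that `J` is integrable and the
Kähler form is closed). -/
structure IsKahler
    (g : ContMDiffRiemannianMetric 𝓘(ℝ, E) ∞ E (fun x : M => TangentSpace 𝓘(ℝ, E) x))
    (J : ∀ x : M, TangentSpace 𝓘(ℝ, E) x →L[ℝ] TangentSpace 𝓘(ℝ, E) x) : Prop where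
  smooth : ContMDiff 𝓘(ℝ, E) (𝓘(ℝ, E).prod 𝓘(ℝ, E →L[ℝ] E)) ∞
    (fun x => TotalSpace.mk' (E →L[ℝ] E)
      (E := fun x : M => TangentSpace 𝓘(ℝ, E) x →L[ℝ] TangentSpace 𝓘(ℝ, E) x) x (J x))
  sq_eq_neg : ∀ (x : M) (v : TangentSpace 𝓘(ℝ, E) x), J x (J x v) = -v
  hermitian : ∀ (x : M) (u v : TangentSpace 𝓘(ℝ, E) x),
    g.inner x (J x u) (J x v) = g.inner x u v
  /-- `(∇_u J) v = ∂_u (J v) + Γ(u, J v) - J Γ(u, v)` vanishes in the charts of `M`. -/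
  parallel : ∀ (p : M), ∀ y ∈ (extChartAt 𝓘(ℝ, E) p).target, ∀ u v : E,
    fderiv ℝ (endoCoord J p) y u v
      + christoffel (metricCoord g.inner p) y u (endoCoord J p y v)
      - endoCoord J p y (christoffel (metricCoord g.inner p) y u v) = 0

/-- `ξ` is a unit vector at `x` orthogonal to the distribution `D`. -/
def IsUnitNormal
    (g : ContMDiffRiemannianMetric 𝓘(ℝ, E) ∞ E (fun x : M => TangentSpace 𝓘(ℝ, E) x))
    (D : ∀ x : M, Submodule ℝ (TangentSpace 𝓘(ℝ, E) x)) (x : M)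
    (ξ : TangentSpace 𝓘(ℝ, E) x) : Prop :=
  g.inner x ξ ξ = 1 ∧ ∀ v ∈ D x, g.inner x ξ v = 0

/-- `D` is a smooth `J`-invariant distribution of (real) codimension two. If `ξ` is a unit vector
orthogonal to `D x`, then the orthogonal complement of `D x` is the span of `ξ` and `J ξ`. -/
structure IsInvariantDistribution
    (g : ContMDiffRiemannianMetric 𝓘(ℝ, E) ∞ E (fun x : M => TangentSpace 𝓘(ℝ, E) x))
    (J : ∀ x : M, TangentSpace 𝓘(ℝ, E) x →L[ℝ] TangentSpace 𝓘(ℝ, E) x)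
    (D : ∀ x : M, Submodule ℝ (TangentSpace 𝓘(ℝ, E) x)) : Prop where
  invariant : ∀ (x : M), ∀ v ∈ D x, J x v ∈ D x
  codim_two : ∀ x : M, Module.finrank ℝ (D x) + 2 = Module.finrank ℝ E
  smooth : ∀ x : M, ∃ U ∈ 𝓝 x, ∃ ξ : ∀ y : M, TangentSpace 𝓘(ℝ, E) y,
    ContMDiffOn 𝓘(ℝ, E) (𝓘(ℝ, E).prod 𝓘(ℝ, E)) ∞
      (fun y => TotalSpace.mk' E (E := fun y : M => TangentSpace 𝓘(ℝ, E) y) y (ξ y)) U ∧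
    ∀ y ∈ U, IsUnitNormal g D y (ξ y)

section Tensors

/-! The three algebraic curvature tensors on a real vector space with inner product `g`, complex
structure `J` and a vector `ξ`; here `η = g(ξ, ·)` and `η' = g(Jξ, ·)`. -/

variable {V : Type*} (g : V → V → ℝ) (J : V → V) (ξ : V)

/-- The curvature tensor `π` of constant holomorphic sectional curvature `1`. -/
def tensorPi (X Y Z U : V) : ℝ :=
  (g Y Z * g X U - g X Z * g Y U + g (J Y) Z * g (J X) U - g (J X) Z * g (J Y) U
    - 2 * (g (J X) Y * g (J Z) U)) / 4

/-- The tensor `Φ`. -/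
def tensorPhi (X Y Z U : V) : ℝ :=
  let η := g ξ
  let η' := g (J ξ)
  (g Y Z * (η X * η U + η' X * η' U) - g X Z * (η Y * η U + η' Y * η' U)
    + g X U * (η Y * η Z + η' Y * η' Z) - g Y U * (η X * η Z + η' X * η' Z)
    + g (J Y) Z * (η X * η' U - η U * η' X) - g (J X) Z * (η Y * η' U - η U * η' Y)
    + g (J X) U * (η Y * η' Z - η Z * η' Y) - g (J Y) U * (η X * η' Z - η Z * η' X)
    - 2 * (g (J X) Y * (η Z * η' U - η U * η' Z))
    - 2 * (g (J Z) U * (η X * η' Y - η Y * η' X))) / 8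

/-- The tensor `Ψ`. -/
def tensorPsi (X Y Z U : V) : ℝ :=
  let η := g ξ
  let η' := g (J ξ)
  η Y * η Z * η' X * η' U - η X * η Z * η' Y * η' U
    + η X * η U * η' Y * η' Z - η Y * η U * η' X * η' Z

end Tensors

/-- Quasi-constant holomorphic sectional curvatures: for a unit vector `X` at `x`, the sectional
curvature `R(X, JX, JX, X)` of the plane spanned by `X` and `J X` depends only on `x` and on the
angle `φ ∈ [0, π/2]` between this plane and the orthogonal complement of `D x`. The
orthogonal projection of `X` to that complement has length `√(η(X)² + η'(X)²) = cos φ`. -/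
def IsQuasiConstant
    (g : ContMDiffRiemannianMetric 𝓘(ℝ, E) ∞ E (fun x : M => TangentSpace 𝓘(ℝ, E) x))
    (J : ∀ x : M, TangentSpace 𝓘(ℝ, E) x →L[ℝ] TangentSpace 𝓘(ℝ, E) x)
    (D : ∀ x : M, Submodule ℝ (TangentSpace 𝓘(ℝ, E) x)) : Prop :=
  ∃ k : M → ℝ → ℝ, ∀ (x : M) (ξ X : TangentSpace 𝓘(ℝ, E) x),
    IsUnitNormal g D x ξ → g.inner x X X = 1 →
    riemann g.inner x X (J x X) (J x X) X =
      k x (Real.arccos (Real.sqrt (g.inner x ξ X ^ 2 + g.inner x (J x ξ) X ^ 2)))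

/-- `R = a π + b Φ + c Ψ` on `M`. (`Φ` and `Ψ` do not depend on the choice of the unit vector `ξ`
in the orthogonal complement of `D`.) -/
def HasCurvatureCoefficients
    (g : ContMDiffRiemannianMetric 𝓘(ℝ, E) ∞ E (fun x : M => TangentSpace 𝓘(ℝ, E) x))
    (J : ∀ x : M, TangentSpace 𝓘(ℝ, E) x →L[ℝ] TangentSpace 𝓘(ℝ, E) x)
    (D : ∀ x : M, Submodule ℝ (TangentSpace 𝓘(ℝ, E) x)) (a b c : M → ℝ) : Prop :=
  ∀ (x : M) (ξ : TangentSpace 𝓘(ℝ, E) x), IsUnitNormal g D x ξ →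
    ∀ X Y Z U : TangentSpace 𝓘(ℝ, E) x,
      riemann g.inner x X Y Z U =
        a x * tensorPi (fun u v => g.inner x u v) (J x) X Y Z U
        + b x * tensorPhi (fun u v => g.inner x u v) (J x) ξ X Y Z U
        + c x * tensorPsi (fun u v => g.inner x u v) (J x) ξ X Y Z U

/-! ## Lagrangian submanifolds -/

variable {F : Type*} [NormedAddCommGroup F] [NormedSpace ℝ F]
  {N : Type*} [TopologicalSpace N] [ChartedSpace F N]

/-- `f : N → M` is a Lagrangian immersion: a smooth immersion with `2 dim N = dim M` such that `J`
carries the tangent spaces of `N` into the normal spaces. -/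
structure IsLagrangianImmersion
    (g : ContMDiffRiemannianMetric 𝓘(ℝ, E) ∞ E (fun x : M => TangentSpace 𝓘(ℝ, E) x))
    (J : ∀ x : M, TangentSpace 𝓘(ℝ, E) x →L[ℝ] TangentSpace 𝓘(ℝ, E) x) (f : N → M) : Prop where
  smooth : ContMDiff 𝓘(ℝ, F) 𝓘(ℝ, E) ∞ f
  immersion : ∀ p : N, Function.Injective (mfderiv 𝓘(ℝ, F) 𝓘(ℝ, E) f p)
  finrank_eq : Module.finrank ℝ E = 2 * Module.finrank ℝ F
  lagrangian : ∀ (p : N) (u v : TangentSpace 𝓘(ℝ, F) p),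
    g.inner (f p) (J (f p) (mfderiv 𝓘(ℝ, F) 𝓘(ℝ, E) f p u)) (mfderiv 𝓘(ℝ, F) 𝓘(ℝ, E) f p v) = 0

/-- The induced metric on `N`. -/
def inducedMetric
    (g : ContMDiffRiemannianMetric 𝓘(ℝ, E) ∞ E (fun x : M => TangentSpace 𝓘(ℝ, E) x))
    (f : N → M) (p : N) : TangentSpace 𝓘(ℝ, F) p →L[ℝ] TangentSpace 𝓘(ℝ, F) p →L[ℝ] ℝ :=
  pullbackForm (g.inner (f p)) (mfderiv 𝓘(ℝ, F) 𝓘(ℝ, E) f p)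

/-- The tangential component `w^⊤ ∈ T_p N` of `w ∈ T_{f p} M`: the vector representing the linear
form `v ↦ g(w, df v)` with respect to the induced metric. -/
def tangentPart
    (g : ContMDiffRiemannianMetric 𝓘(ℝ, E) ∞ E (fun x : M => TangentSpace 𝓘(ℝ, E) x))
    (f : N → M) (p : N) (w : TangentSpace 𝓘(ℝ, E) (f p)) : TangentSpace 𝓘(ℝ, F) p :=
  (inducedMetric g f p).inverse ((g.inner (f p) w).comp (mfderiv 𝓘(ℝ, F) 𝓘(ℝ, E) f p))

/-- The normal component of `w ∈ T_{f p} M`. -/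
def normalPart
    (g : ContMDiffRiemannianMetric 𝓘(ℝ, E) ∞ E (fun x : M => TangentSpace 𝓘(ℝ, E) x))
    (f : N → M) (p : N) (w : TangentSpace 𝓘(ℝ, E) (f p)) : TangentSpace 𝓘(ℝ, E) (f p) :=
  w - mfderiv 𝓘(ℝ, F) 𝓘(ℝ, E) f p (tangentPart (F := F) g f p w)

variable [IsManifold 𝓘(ℝ, F) ∞ N]

/-- The second fundamental form `h(u, v)` at `p`: the normal component of the ambient covariant
derivative `∂_u ∂_v f + Γ(∂_u f, ∂_v f)`, computed in the charts around `p` and `f p`. -/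
def secondFundamentalForm
    (g : ContMDiffRiemannianMetric 𝓘(ℝ, E) ∞ E (fun x : M => TangentSpace 𝓘(ℝ, E) x))
    (f : N → M) (p : N) (u v : TangentSpace 𝓘(ℝ, F) p) : TangentSpace 𝓘(ℝ, E) (f p) :=
  let φ : F → E := writtenInExtChartAt 𝓘(ℝ, F) 𝓘(ℝ, E) p f
  let y : F := extChartAt 𝓘(ℝ, F) p p
  let u' : F := coordsAt p p u
  let v' : F := coordsAt p p v
  normalPart (F := F) g f p (frameAt (f p) (f p)
    (fderiv ℝ (fderiv ℝ φ) y u' v'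
      + christoffel (metricCoord g.inner (f p)) (φ y) (fderiv ℝ φ y u') (fderiv ℝ φ y v')))

/-- The mean curvature vector `H = (1/n) ∑ h(e_i, e_i)` at `p`, where `e` is an orthonormal basis
of `T_p N` and `n = dim N`. -/
def meanCurvature [FiniteDimensional ℝ F]
    (g : ContMDiffRiemannianMetric 𝓘(ℝ, E) ∞ E (fun x : M => TangentSpace 𝓘(ℝ, E) x))
    (f : N → M) (p : N) : TangentSpace 𝓘(ℝ, E) (f p) :=
  (1 / (Module.finrank ℝ F : ℝ)) •
    metricTrace (fun u v => inducedMetric (F := F) g f p u v)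
      (fun u v => secondFundamentalForm (F := F) g f p u v)

/-- `p` is a totally geodesic point: the second fundamental form vanishes at `p`. -/
def IsTotallyGeodesicAt
    (g : ContMDiffRiemannianMetric 𝓘(ℝ, E) ∞ E (fun x : M => TangentSpace 𝓘(ℝ, E) x))
    (f : N → M) (p : N) : Prop :=
  ∀ u v : TangentSpace 𝓘(ℝ, F) p, secondFundamentalForm g f p u v = 0

/-- `p` is an `H`-umbilical point with the numbers `lam` and `mu`: for some orthonormal basis `e`
of `T_p N` with a distinguished element `e_i₀` (the first one),
`h(e_i₀, e_i₀) = lam J e_i₀`, `h(e_j, e_j) = mu J e_i₀`, `h(e_i₀, e_j) = mu J e_j`, and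
`h(e_j, e_k) = 0` for `j ≠ k` different from `i₀`. -/
def IsHUmbilicalAt
    (g : ContMDiffRiemannianMetric 𝓘(ℝ, E) ∞ E (fun x : M => TangentSpace 𝓘(ℝ, E) x))
    (J : ∀ x : M, TangentSpace 𝓘(ℝ, E) x →L[ℝ] TangentSpace 𝓘(ℝ, E) x)
    (f : N → M) (p : N) (lam mu : ℝ) : Prop :=
  ∃ (e : Fin (Module.finrank ℝ F) → TangentSpace 𝓘(ℝ, F) p) (i₀ : Fin (Module.finrank ℝ F)),
    (∀ i j, inducedMetric g f p (e i) (e j) = if i = j then 1 else 0) ∧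
    secondFundamentalForm g f p (e i₀) (e i₀) =
      lam • J (f p) (mfderiv 𝓘(ℝ, F) 𝓘(ℝ, E) f p (e i₀)) ∧
    (∀ j, j ≠ i₀ → secondFundamentalForm g f p (e j) (e j) =
      mu • J (f p) (mfderiv 𝓘(ℝ, F) 𝓘(ℝ, E) f p (e i₀))) ∧
    (∀ j, j ≠ i₀ → secondFundamentalForm g f p (e i₀) (e j) =
      mu • J (f p) (mfderiv 𝓘(ℝ, F) 𝓘(ℝ, E) f p (e j))) ∧
    (∀ j k, j ≠ i₀ → k ≠ i₀ → j ≠ k → secondFundamentalForm g f p (e j) (e k) = 0)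

/-- The right-hand side of the Chen-Ricci inequality at `p`, for a tangent vector `X` of `N`, a unit
vector `ξ` at `f p` orthogonal to the distribution, and the values `a`, `b`, `c` of the
curvature coefficients at `f p`; `η = g(ξ, ·)`, `η' = g(Jξ, ·)`, and `n = dim N`. -/
def chenRicciBound [FiniteDimensional ℝ F]
    (g : ContMDiffRiemannianMetric 𝓘(ℝ, E) ∞ E (fun x : M => TangentSpace 𝓘(ℝ, E) x))
    (J : ∀ x : M, TangentSpace 𝓘(ℝ, E) x →L[ℝ] TangentSpace 𝓘(ℝ, E) x)
    (f : N → M) (p : N) (ξ : TangentSpace 𝓘(ℝ, E) (f p)) (a b c : ℝ)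
    (X : TangentSpace 𝓘(ℝ, F) p) : ℝ :=
  let n : ℝ := Module.finrank ℝ F
  let ηX : ℝ := g.inner (f p) ξ (mfderiv 𝓘(ℝ, F) 𝓘(ℝ, E) f p X)
  let η'X : ℝ := g.inner (f p) (J (f p) ξ) (mfderiv 𝓘(ℝ, F) 𝓘(ℝ, E) f p X)
  let W : TangentSpace 𝓘(ℝ, F) p :=
    ηX • tangentPart g f p (J (f p) ξ) - η'X • tangentPart g f p ξ
  let H : TangentSpace 𝓘(ℝ, E) (f p) := meanCurvature (F := F) g f p
  (n - 1) / 4 * a + 1 / 8 * ((n - 2) * (ηX ^ 2 + η'X ^ 2) + 1) * b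
    + inducedMetric g f p W W * c + (n - 1) * n / 4 * g.inner (f p) H H

end Manifold

end

end QCH

/-! The Ricci curvature of the Lagrangian submanifold is computed by the Gauss equation
(`gauss_equation`). The ambient part is a purely algebraic sum over an orthonormal basis
(`IsLagrangianForm.sum_curvature_eq`), and it produces exactly the terms with `a`, `b` and `c` of the
bound. What remains is an inequality for the second fundamental form at one point:
`∑ (g(h(X, X), h(e_i, e_i)) - |h(X, e_i)|²) ≤ n (n - 1) / 4 |H|²`.

Since `J` is parallel and the tangent spaces are Lagrangian, `g(h(u, v), J df w)` is symmetric in all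
three arguments (`isLagrangianForm`), and `J` carries an orthonormal basis of the tangent space to one
of the normal space. So the inequality concerns a totally symmetric array, and there the difference of
the two sides is bounded below by a sum of squares (`sum_cubic_form_le`). If equality holds in every
direction, all these squares vanish for every orthonormal basis. One of them has the coefficient
`(n - 2) / (8 n)`. For `n ≥ 3` it forces `H = 0`, and then the others force `h = 0`. For `n = 2` it is
absent, and in a basis whose second vector is orthogonal to `J H` the others say that `h` is
`H`-umbilical with `λ = 3 μ`; a direct computation gives the converse.

All geometric objects are defined by coordinate expressions in preferred charts. The Gauss equation
and the symmetry of the cubic form are therefore proved for maps `φ : F → E` between vector spaces with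
metrics given by `G : E → E →L[ℝ] E →L[ℝ] ℝ`, by calculus with the covariant derivative along `φ`
(`gauss_equation_coord`, `metric_hessianAlong_J_symm`), and carried over by `mfderiv_frameAt`, which
says that the differential of `f` in coordinate frames is the derivative of its coordinate
expression. -/

namespace QCH

noncomputable section

/-! ### Coordinates: the Levi-Civita connection -/

section Coordinates

variable {E : Type*} [NormedAddCommGroup E] [NormedSpace ℝ E]

theorem exists_continuousLinearEquiv_dual [FiniteDimensional ℝ E] {B : E →L[ℝ] E →L[ℝ] ℝ}
    (hB : Function.Injective B) :
    ∃ e : E ≃L[ℝ] (E →L[ℝ] ℝ), (e : E →L[ℝ] E →L[ℝ] ℝ) = B := by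
  have hfin : Module.finrank ℝ E = Module.finrank ℝ (E →L[ℝ] ℝ) := by
    rw [← (LinearMap.toContinuousLinearMap (𝕜 := ℝ) (E := E) (F' := ℝ)).finrank_eq]
    exact (Subspace.dual_finrank_eq (K := ℝ) (V := E)).symm
  exact ⟨(LinearEquiv.ofInjectiveOfFinrankEq (B : E →ₗ[ℝ] E →L[ℝ] ℝ) hB
    hfin).toContinuousLinearEquiv, by ext v; rfl⟩

theorem christoffelFirst_apply (G : E → E →L[ℝ] E →L[ℝ] ℝ) (y u v w : E) :
    christoffelFirst G y u v w =
      1 / 2 * (fderiv ℝ G y u v w + fderiv ℝ G y v u w - fderiv ℝ G y w u v) := by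
  simp [christoffelFirst, cycleForm]

theorem christoffel_apply (G : E → E →L[ℝ] E →L[ℝ] ℝ) (y u v : E) :
    christoffel G y u v = (G y).inverse (christoffelFirst G y u v) := rfl

/-- `G` is the coordinate matrix of a Riemannian metric near `y`: it is of class `C²` at `y`, and
symmetric and positive definite at all points near `y`. Two derivatives are what the curvature at
`y` needs; a finite order of smoothness, unlike `C^∞` at a point, persists near `y`. -/
structure IsMetricNear (G : E → E →L[ℝ] E →L[ℝ] ℝ) (y : E) : Prop where
  contDiffAt : ContDiffAt ℝ 2 G y
  symm : ∀ᶠ z in 𝓝 y, ∀ u v, G z u v = G z v u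
  pos : ∀ᶠ z in 𝓝 y, ∀ u, u ≠ 0 → 0 < G z u u

namespace IsMetricNear

variable {G : E → E →L[ℝ] E →L[ℝ] ℝ} {y : E}

theorem eventually (h : IsMetricNear G y) : ∀ᶠ z in 𝓝 y, IsMetricNear G z := by
  filter_upwards [h.contDiffAt.eventually (by simp), h.symm.eventually_nhds,
    h.pos.eventually_nhds] with z h1 h2 h3 using ⟨h1, h2, h3⟩

theorem differentiableAt (h : IsMetricNear G y) : DifferentiableAt ℝ G y :=
  h.contDiffAt.differentiableAt (by simp)

theorem fderiv_symm (h : IsMetricNear G y) (u v w : E) :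
    fderiv ℝ G y u v w = fderiv ℝ G y u w v := by
  have e (a b : E) : fderiv ℝ (fun z => G z a b) y u = fderiv ℝ G y u a b := by
    have := ((h.differentiableAt.hasFDerivAt.clm_apply (hasFDerivAt_const a y)).clm_apply
      (hasFDerivAt_const b y)).fderiv
    rw [this]; simp
  rw [← e, ← e]
  congr 1
  exact Filter.EventuallyEq.fderiv_eq (h.symm.mono fun z hz => hz v w)

theorem christoffel_comm (h : IsMetricNear G y) (u v : E) :
    christoffel G y u v = christoffel G y v u := by
  rw [christoffel_apply, christoffel_apply]
  congr 1
  ext w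
  rw [christoffelFirst_apply, christoffelFirst_apply, h.fderiv_symm w u v]
  ring

variable [FiniteDimensional ℝ E]

theorem exists_equiv (h : IsMetricNear G y) :
    ∃ e : E ≃L[ℝ] (E →L[ℝ] ℝ), (e : E →L[ℝ] E →L[ℝ] ℝ) = G y := by
  apply exists_continuousLinearEquiv_dual
  rw [injective_iff_map_eq_zero]
  intro u hu
  by_contra hne
  have := h.pos.self_of_nhds u hne
  simp [hu] at this

/-- Raising the index does what it should: `christoffel` is not the junk value of a non-invertible
`ContinuousLinearMap.inverse`. -/
theorem apply_christoffel (h : IsMetricNear G y) (u v w : E) :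
    G y (christoffel G y u v) w = christoffelFirst G y u v w := by
  obtain ⟨e, he⟩ := h.exists_equiv
  rw [christoffel_apply, ← he]
  simp

/-- The Levi-Civita connection is metric: `∂_u G(v, w) = G(Γ(u, v), w) + G(v, Γ(u, w))`. -/
theorem fderiv_eq_christoffel (h : IsMetricNear G y) (u v w : E) :
    fderiv ℝ G y u v w = G y (christoffel G y u v) w + G y v (christoffel G y u w) := by
  rw [h.symm.self_of_nhds v, h.apply_christoffel, h.apply_christoffel, christoffelFirst_apply,
    christoffelFirst_apply, h.fderiv_symm w u v, h.fderiv_symm v u w, h.fderiv_symm u w v]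
  ring

theorem christoffel_differentiableAt (h : IsMetricNear G y) :
    DifferentiableAt ℝ (christoffel G) y := by
  obtain ⟨e, he⟩ := h.exists_equiv
  have h1 : DifferentiableAt ℝ (fderiv ℝ G) y :=
    (h.contDiffAt.fderiv_right (m := 1) (by norm_num)).differentiableAt (by simp)
  have h2 : DifferentiableAt ℝ (christoffelFirst G) y := by
    unfold christoffelFirst cycleForm
    have hflip : DifferentiableAt ℝ (fun z => (fderiv ℝ G z).flip) y :=
      ((ContinuousLinearMap.flipₗᵢ ℝ E E (E →L[ℝ] ℝ)).toContinuousLinearEquiv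
        |>.toContinuousLinearMap).differentiableAt.comp y h1
    exact DifferentiableAt.const_smul (𝕜 := ℝ)
      ((h1.add hflip).sub ((differentiableAt_const _).clm_comp hflip)) (1 / 2 : ℝ)
  have h3 : DifferentiableAt ℝ (fun z => (G z).inverse) y := by
    have := (contDiffAt_map_inverse (𝕜 := ℝ) (n := 1) e).differentiableAt (by simp)
    rw [he] at this
    exact this.comp y h.differentiableAt
  unfold christoffel
  exact ((ContinuousLinearMap.differentiableAt _).comp y h3).clm_comp h2

end IsMetricNear

variable {F : Type*} [NormedAddCommGroup F] [NormedSpace ℝ F]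

/-! ### Covariant derivatives along a map -/

/-- The covariant derivative, along the map `φ` and in the direction `u`, of a vector field `V`
along `φ`. -/
def covDerivAlong (G : E → E →L[ℝ] E →L[ℝ] ℝ) (φ : F → E) (V : F → E) (y u : F) : E :=
  fderiv ℝ V y u + christoffel G (φ y) (fderiv ℝ φ y u) (V y)

/-- The second derivative `∇_u (dφ v)` of `φ` for a constant field `v`, with the ambient
covariant derivative. -/
def hessianAlong (G : E → E →L[ℝ] E →L[ℝ] ℝ) (φ : F → E) (y u v : F) : E :=
  fderiv ℝ (fderiv ℝ φ) y u v + christoffel G (φ y) (fderiv ℝ φ y u) (fderiv ℝ φ y v)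

section

variable {G : E → E →L[ℝ] E →L[ℝ] ℝ} {φ : F → E} {y : F}

theorem covDerivAlong_fderiv (hφ : ContDiffAt ℝ 3 φ y) (u v : F) :
    covDerivAlong G φ (fun z => fderiv ℝ φ z v) y u = hessianAlong G φ y u v := by
  have h1 : DifferentiableAt ℝ (fderiv ℝ φ) y :=
    (hφ.fderiv_right (m := 2) (by norm_num)).differentiableAt (by simp)
  have := (h1.hasFDerivAt.clm_apply (hasFDerivAt_const v y)).fderiv
  rw [covDerivAlong, this]
  simp [hessianAlong]

theorem hessianAlong_comm (h : IsMetricNear G (φ y)) (hφ : ContDiffAt ℝ 3 φ y) (u v : F) :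
    hessianAlong G φ y u v = hessianAlong G φ y v u := by
  have := hφ.isSymmSndFDerivAt (by simp; norm_num) u v
  rw [hessianAlong, hessianAlong, this, h.christoffel_comm]

variable [FiniteDimensional ℝ E]

/-- The product rule for the metric along `φ`. With `φ = id` it is the metric property of the
connection itself. -/
theorem fderiv_metric_along (h : IsMetricNear G (φ y)) (hφ : DifferentiableAt ℝ φ y)
    {V W : F → E} (hV : DifferentiableAt ℝ V y) (hW : DifferentiableAt ℝ W y) (u : F) :
    fderiv ℝ (fun z => G (φ z) (V z) (W z)) y u =
      G (φ y) (covDerivAlong G φ V y u) (W y) + G (φ y) (V y) (covDerivAlong G φ W y u) := by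
  have h1 := h.differentiableAt.hasFDerivAt.comp y hφ.hasFDerivAt
  have h2 : HasFDerivAt (fun z => G (φ z) (V z) (W z)) _ y :=
    (h1.clm_apply hV.hasFDerivAt).clm_apply hW.hasFDerivAt
  rw [h2.fderiv]
  simp [covDerivAlong, h.fderiv_eq_christoffel]
  ring

theorem hessianAlong_differentiableAt (h : IsMetricNear G (φ y)) (hφ : ContDiffAt ℝ 3 φ y)
    (v w : F) : DifferentiableAt ℝ (fun z => hessianAlong G φ z v w) y := by
  have h1 : ContDiffAt ℝ 2 (fderiv ℝ φ) y := hφ.fderiv_right (by norm_num)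
  have h1' := h1.differentiableAt (by simp)
  have h2 : DifferentiableAt ℝ (fderiv ℝ (fderiv ℝ φ)) y :=
    (h1.fderiv_right (m := 1) (by norm_num)).differentiableAt (by simp)
  have h3 : DifferentiableAt ℝ (fun z => christoffel G (φ z)) y :=
    h.christoffel_differentiableAt.comp y (hφ.differentiableAt (by simp))
  unfold hessianAlong
  fun_prop

/-- The curvature of the connection pulled back along `φ`, on the fields `dφ w`, is the pullback of
the curvature. The third derivatives of `φ` and the terms `Γ(∂_u ∂_v φ, dφ w)` cancel by symmetry;
`Γ(dφ v, ∂_u ∂_w φ)` and `Γ(dφ u, ∂_v ∂_w φ)` each occur with both signs. -/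
theorem covDerivAlong_hessianAlong_sub (h : IsMetricNear G (φ y)) (hφ : ContDiffAt ℝ 3 φ y)
    (u v w : F) :
    covDerivAlong G φ (fun z => hessianAlong G φ z v w) y u
      - covDerivAlong G φ (fun z => hessianAlong G φ z u w) y v
      = curvatureCoord G (φ y) (fderiv ℝ φ y u) (fderiv ℝ φ y v) (fderiv ℝ φ y w) := by
  have h1 : ContDiffAt ℝ 2 (fderiv ℝ φ) y := hφ.fderiv_right (by norm_num)
  have h1' := (h1.differentiableAt (by simp)).hasFDerivAt
  have h2 := ((h1.fderiv_right (m := 1) (by norm_num)).differentiableAt (by simp)).hasFDerivAt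
  have h3 := h.christoffel_differentiableAt.hasFDerivAt.comp y
    (hφ.differentiableAt (by simp)).hasFDerivAt
  have key (a b c : F) : fderiv ℝ (fun z => hessianAlong G φ z b c) y a =
      fderiv ℝ (fderiv ℝ (fderiv ℝ φ)) y a b c
      + fderiv ℝ (christoffel G) (φ y) (fderiv ℝ φ y a) (fderiv ℝ φ y b) (fderiv ℝ φ y c)
      + christoffel G (φ y) (fderiv ℝ (fderiv ℝ φ) y a b) (fderiv ℝ φ y c)
      + christoffel G (φ y) (fderiv ℝ φ y b) (fderiv ℝ (fderiv ℝ φ) y a c) := by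
    have hb := h1'.clm_apply (hasFDerivAt_const b y)
    have hc := h1'.clm_apply (hasFDerivAt_const c y)
    have : HasFDerivAt (fun z => hessianAlong G φ z b c) _ y :=
      ((h2.clm_apply (hasFDerivAt_const b y)).clm_apply (hasFDerivAt_const c y)).add
        ((h3.clm_apply hb).clm_apply hc)
    rw [this.fderiv]
    simp
    abel
  have s3 : fderiv ℝ (fderiv ℝ (fderiv ℝ φ)) y u v = fderiv ℝ (fderiv ℝ (fderiv ℝ φ)) y v u :=
    h1.isSymmSndFDerivAt (by simp) u v
  have s2 : fderiv ℝ (fderiv ℝ φ) y u v = fderiv ℝ (fderiv ℝ φ) y v u :=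
    hφ.isSymmSndFDerivAt (by simp; norm_num) u v
  rw [covDerivAlong, covDerivAlong, key, key, curvatureCoord, s3, s2]
  simp only [hessianAlong, map_add]
  abel

end

/-! ### The Gauss equation in coordinates -/

section Gauss

variable {G : E → E →L[ℝ] E →L[ℝ] ℝ} {φ : F → E}
  {y : F} {G' : F → F →L[ℝ] F →L[ℝ] ℝ}

/-- The pullback of a metric by an immersion is a metric. -/
theorem IsMetricNear.of_isometry (h : IsMetricNear G (φ y)) (hφ : ContDiffAt ℝ 3 φ y)
    (hinj : ∀ᶠ z in 𝓝 y, Function.Injective (fderiv ℝ φ z))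
    (hG' : ∀ᶠ z in 𝓝 y, ∀ u v, G' z u v = G (φ z) (fderiv ℝ φ z u) (fderiv ℝ φ z v)) :
    IsMetricNear G' y := by
  have hc := hφ.continuousAt
  refine ⟨?_, ?_, ?_⟩
  · have h1 : ContDiffAt ℝ 2 (fderiv ℝ φ) y := hφ.fderiv_right (by norm_num)
    have h2 : ContDiffAt ℝ 2 (fun z => G (φ z)) y :=
      h.contDiffAt.comp y (hφ.of_le (by norm_num))
    have h3 : ContDiffAt ℝ 2
        (fun z => (ContinuousLinearMap.precomp ℝ (fderiv ℝ φ z)).comp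
          ((G (φ z)).comp (fderiv ℝ φ z))) y :=
      ContDiffAt.clm_comp
        (((ContinuousLinearMap.compL ℝ F E ℝ).flip).contDiff.contDiffAt.comp y h1)
        (h2.clm_comp h1)
    refine h3.congr_of_eventuallyEq ?_
    filter_upwards [hG'] with z hz
    ext u v
    rw [hz]
    rfl
  · filter_upwards [hG', hc.eventually h.symm] with z hz hs u v
    rw [hz, hz, hs]
  · filter_upwards [hG', hc.eventually h.pos, hinj] with z hz hs hi u hu
    rw [hz]
    exact hs _ (by simpa using hi.ne hu)

/-- The second fundamental form `∇_u (dφ v) - dφ Γ'(u, v)` in coordinates, where `Γ'` belongs to the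
induced metric `G'`. -/
def sffCoord (G : E → E →L[ℝ] E →L[ℝ] ℝ) (G' : F → F →L[ℝ] F →L[ℝ] ℝ) (φ : F → E)
    (y u v : F) : E :=
  hessianAlong G φ y u v - fderiv ℝ φ y (christoffel G' y u v)

theorem sffCoord_comm (h : IsMetricNear G (φ y)) (hφ : ContDiffAt ℝ 3 φ y)
    (h' : IsMetricNear G' y) (u v : F) :
    sffCoord G G' φ y u v = sffCoord G G' φ y v u := by
  rw [sffCoord, sffCoord, hessianAlong_comm h hφ, h'.christoffel_comm]

variable [FiniteDimensional ℝ E] [FiniteDimensional ℝ F]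

/-- The tangential part of `∇_u (dφ v)` is given by the Levi-Civita connection of the induced
metric: both satisfy the Koszul formula. -/
theorem metric_hessianAlong_fderiv (h : IsMetricNear G (φ y)) (hφ : ContDiffAt ℝ 3 φ y)
    (h' : IsMetricNear G' y)
    (hG' : ∀ᶠ z in 𝓝 y, ∀ u v, G' z u v = G (φ z) (fderiv ℝ φ z u) (fderiv ℝ φ z v))
    (u v w : F) :
    G (φ y) (hessianAlong G φ y u v) (fderiv ℝ φ y w) = G' y (christoffel G' y u v) w := by
  have h1 : DifferentiableAt ℝ (fderiv ℝ φ) y :=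
    (hφ.fderiv_right (m := 2) (by norm_num)).differentiableAt (by simp)
  have key (a b c : F) : fderiv ℝ G' y a b c =
      G (φ y) (hessianAlong G φ y a b) (fderiv ℝ φ y c)
        + G (φ y) (hessianAlong G φ y a c) (fderiv ℝ φ y b) := by
    have e : fderiv ℝ (fun z => G' z b c) y a = fderiv ℝ G' y a b c := by
      rw [((h'.differentiableAt.hasFDerivAt.clm_apply (hasFDerivAt_const b y)).clm_apply
        (hasFDerivAt_const c y)).fderiv]
      simp
    have e2 : (fun z => G' z b c) =ᶠ[𝓝 y] fun z => G (φ z) (fderiv ℝ φ z b) (fderiv ℝ φ z c) :=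
      hG'.mono fun z hz => hz b c
    rw [← e, e2.fderiv_eq, fderiv_metric_along h (hφ.differentiableAt (by simp))
      (h1.clm_apply (differentiableAt_const b)) (h1.clm_apply (differentiableAt_const c)),
      covDerivAlong_fderiv hφ, covDerivAlong_fderiv hφ,
      h.symm.self_of_nhds (fderiv ℝ φ y b)]
  rw [h'.apply_christoffel, christoffelFirst_apply, key, key, key,
    hessianAlong_comm h hφ v u, hessianAlong_comm h hφ w u, hessianAlong_comm h hφ w v]
  ring

theorem metric_sffCoord_fderiv (h : IsMetricNear G (φ y)) (hφ : ContDiffAt ℝ 3 φ y)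
    (h' : IsMetricNear G' y)
    (hG' : ∀ᶠ z in 𝓝 y, ∀ u v, G' z u v = G (φ z) (fderiv ℝ φ z u) (fderiv ℝ φ z v))
    (u v w : F) :
    G (φ y) (sffCoord G G' φ y u v) (fderiv ℝ φ y w) = 0 := by
  rw [sffCoord, map_sub, sub_apply, metric_hessianAlong_fderiv h hφ h' hG',
    hG'.self_of_nhds, sub_self]

theorem metric_hessianAlong_hessianAlong (h : IsMetricNear G (φ y)) (hφ : ContDiffAt ℝ 3 φ y)
    (h' : IsMetricNear G' y)
    (hG' : ∀ᶠ z in 𝓝 y, ∀ u v, G' z u v = G (φ z) (fderiv ℝ φ z u) (fderiv ℝ φ z v))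
    (u v w z : F) :
    G (φ y) (hessianAlong G φ y u v) (hessianAlong G φ y w z) =
      G (φ y) (sffCoord G G' φ y u v) (sffCoord G G' φ y w z)
        + G' y (christoffel G' y u v) (christoffel G' y w z) := by
  have e (a b : F) : hessianAlong G φ y a b =
      sffCoord G G' φ y a b + fderiv ℝ φ y (christoffel G' y a b) := by simp [sffCoord]
  rw [e, e]
  simp only [map_add, add_apply]
  rw [metric_sffCoord_fderiv h hφ h' hG', h.symm.self_of_nhds (fderiv ℝ φ y _),
    metric_sffCoord_fderiv h hφ h' hG', ← hG'.self_of_nhds]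
  ring

/-- **Gauss equation** in coordinates. It comes from differentiating
`G(∇_v (dφ w), dφ z) = G'(Γ'(v, w), z)` in the direction `u` and skew-symmetrizing in `u`, `v`. -/
theorem gauss_equation_coord (h : IsMetricNear G (φ y)) (hφ : ContDiffAt ℝ 3 φ y)
    (h' : IsMetricNear G' y)
    (hG' : ∀ᶠ z in 𝓝 y, ∀ u v, G' z u v = G (φ z) (fderiv ℝ φ z u) (fderiv ℝ φ z v))
    (u v w z : F) :
    G' y (curvatureCoord G' y u v w) z =
      G (φ y) (curvatureCoord G (φ y) (fderiv ℝ φ y u) (fderiv ℝ φ y v) (fderiv ℝ φ y w))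
        (fderiv ℝ φ y z)
      + G (φ y) (sffCoord G G' φ y v w) (sffCoord G G' φ y u z)
      - G (φ y) (sffCoord G G' φ y u w) (sffCoord G G' φ y v z) := by
  have h1 : DifferentiableAt ℝ (fderiv ℝ φ) y :=
    (hφ.fderiv_right (m := 2) (by norm_num)).differentiableAt (by simp)
  have key (a b : F) :
      G (φ y) (covDerivAlong G φ (fun x => hessianAlong G φ x b w) y a) (fderiv ℝ φ y z)
        + G (φ y) (hessianAlong G φ y b w) (hessianAlong G φ y a z) =
      G' y (fderiv ℝ (christoffel G') y a b w + christoffel G' y a (christoffel G' y b w)) z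
        + G' y (christoffel G' y b w) (christoffel G' y a z) := by
    have e : (fun x => G (φ x) (hessianAlong G φ x b w) (fderiv ℝ φ x z)) =ᶠ[𝓝 y]
        fun x => G' x (christoffel G' x b w) z := by
      filter_upwards [hφ.continuousAt.eventually h.eventually, hφ.eventually (by simp),
        h'.eventually, hG'.eventually_nhds] with x h1 h2 h3 h4
      exact metric_hessianAlong_fderiv h1 h2 h3 h4 b w z
    have e1 := fderiv_metric_along h (hφ.differentiableAt (by simp))
      (hessianAlong_differentiableAt h hφ b w) (h1.clm_apply (differentiableAt_const z)) a
    have hchr := ((h'.christoffel_differentiableAt.hasFDerivAt.clm_apply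
      (hasFDerivAt_const b y)).clm_apply (hasFDerivAt_const w y))
    have e2 := fderiv_metric_along (φ := fun x : F => x) (y := y) h' differentiableAt_id
      hchr.differentiableAt (differentiableAt_const z) a
    rw [e.fderiv_eq, e2, covDerivAlong_fderiv hφ] at e1
    rw [← e1]
    simp [covDerivAlong, hchr.fderiv]
  have k1 := key u v
  have k2 := key v u
  rw [metric_hessianAlong_hessianAlong h hφ h' hG'] at k1 k2
  rw [← covDerivAlong_hessianAlong_sub h hφ, curvatureCoord]
  simp only [map_add, map_sub, add_apply, sub_apply]
    at k1 k2 ⊢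
  linarith

end Gauss

/-- For a Lagrangian map and a parallel field `J` of endomorphisms, the trilinear form
`G(∇_u (dφ v), J dφ w)` is symmetric in `v` and `w`: differentiate `G(J dφ w, dφ v) = 0` in the
direction `u`. -/
theorem metric_hessianAlong_J_symm [FiniteDimensional ℝ E] {G : E → E →L[ℝ] E →L[ℝ] ℝ}
    {φ : F → E} {y : F} {J : E → E →L[ℝ] E}
    (h : IsMetricNear G (φ y)) (hφ : ContDiffAt ℝ 3 φ y)
    (hJ : DifferentiableAt ℝ J (φ y))
    (hpar : ∀ u v, fderiv ℝ J (φ y) u v + christoffel G (φ y) u (J (φ y) v)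
      - J (φ y) (christoffel G (φ y) u v) = 0)
    (hskew : ∀ u v, G (φ y) (J (φ y) u) v = -G (φ y) u (J (φ y) v))
    (hlag : ∀ᶠ z in 𝓝 y, ∀ u v, G (φ z) (J (φ z) (fderiv ℝ φ z u)) (fderiv ℝ φ z v) = 0)
    (u v w : F) :
    G (φ y) (hessianAlong G φ y u v) (J (φ y) (fderiv ℝ φ y w)) =
      G (φ y) (hessianAlong G φ y u w) (J (φ y) (fderiv ℝ φ y v)) := by
  have h1 : DifferentiableAt ℝ (fderiv ℝ φ) y :=
    (hφ.fderiv_right (m := 2) (by norm_num)).differentiableAt (by simp)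
  have hφ' := hφ.differentiableAt (by simp)
  have hw := h1.clm_apply (differentiableAt_const w)
  have hJw : HasFDerivAt (fun z => J (φ z) (fderiv ℝ φ z w)) _ y :=
    (hJ.hasFDerivAt.comp y hφ'.hasFDerivAt).clm_apply
      (h1.hasFDerivAt.clm_apply (hasFDerivAt_const w y))
  have e1 := fderiv_metric_along h hφ' hJw.differentiableAt
    (h1.clm_apply (differentiableAt_const v)) u
  have e2 : (fun z => G (φ z) (J (φ z) (fderiv ℝ φ z w)) (fderiv ℝ φ z v)) =ᶠ[𝓝 y]
      fun _ => 0 := hlag.mono fun z hz => hz w v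
  have e3 : covDerivAlong G φ (fun z => J (φ z) (fderiv ℝ φ z w)) y u =
      J (φ y) (hessianAlong G φ y u w) := by
    have := sub_eq_zero.1 (hpar (fderiv ℝ φ y u) (fderiv ℝ φ y w))
    rw [covDerivAlong, hJw.fderiv, hessianAlong, map_add, ← this]
    simp
    abel
  rw [e2.fderiv_eq, e3, covDerivAlong_fderiv hφ, hskew] at e1
  simp only [fderiv_fun_const, Pi.zero_apply, zero_apply] at e1
  rw [h.symm.self_of_nhds (hessianAlong G φ y u v)]
  linarith

end Coordinates

/-! ### Orthonormal bases and traces -/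

section InnerProducts

variable {V : Type*} [AddCommGroup V] [Module ℝ V] [FiniteDimensional ℝ V]

/-- The family `e` is orthonormal for the bilinear form `B`. Tangent spaces carry no norm that comes
from the metric, so the inner product is an explicit bilinear form here. -/
def IsOrthonormalFor {ι : Type*} [DecidableEq ι] (B : V →ₗ[ℝ] V →ₗ[ℝ] ℝ) (e : ι → V) : Prop :=
  ∀ i j, B (e i) (e j) = if i = j then 1 else 0

namespace IsOrthonormalFor

variable {ι : Type*} [Fintype ι] [DecidableEq ι] {B : V →ₗ[ℝ] V →ₗ[ℝ] ℝ} {e : ι → V}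

omit [FiniteDimensional ℝ V] in
theorem linearIndependent (he : IsOrthonormalFor B e) : LinearIndependent ℝ e := by
  rw [Fintype.linearIndependent_iff]
  intro c hc i
  have := congrArg (B (e i)) hc
  simpa [he i, map_sum] using this

theorem sum_smul (he : IsOrthonormalFor B e) (hcard : Fintype.card ι = Module.finrank ℝ V)
    (v : V) : ∑ i, B (e i) v • e i = v := by
  have hspan := he.linearIndependent.span_eq_top_of_card_eq_finrank' hcard
  have hv : v ∈ Submodule.span ℝ (Set.range e) := hspan ▸ Submodule.mem_top
  obtain ⟨c, rfl⟩ := (Submodule.mem_span_range_iff_exists_fun ℝ).1 hv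
  simp [he _ _, map_sum]

theorem sum_mul (he : IsOrthonormalFor B e) (hcard : Fintype.card ι = Module.finrank ℝ V)
    (u v : V) : ∑ i, B (e i) u * B (e i) v = B u v := by
  conv_rhs => rw [← he.sum_smul hcard u, ← he.sum_smul hcard v]
  simp [map_sum, he _ _, LinearMap.sum_apply, mul_comm]

/-- The trace of a bilinear map with respect to an inner product, computed in an orthonormal
basis. If `P` and `Q` are the change of basis matrices, the Gram matrix is `P Pᵀ` and its inverse
`Qᵀ Q`. -/
theorem metricTrace_eq {W : Type*} [AddCommGroup W] [Module ℝ W]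
    {e : Fin (Module.finrank ℝ V) → V} (he : IsOrthonormalFor B e)
    (T : V →ₗ[ℝ] V →ₗ[ℝ] W) :
    metricTrace (fun u v => B u v) (fun u v => T u v) = ∑ i, T (e i) (e i) := by
  have hcard : Fintype.card (Fin (Module.finrank ℝ V)) = Module.finrank ℝ V := by simp
  let b := Module.finBasis ℝ V
  let P : Matrix (Fin (Module.finrank ℝ V)) (Fin (Module.finrank ℝ V)) ℝ :=
    Matrix.of fun i k => B (e k) (b i)
  let Q : Matrix (Fin (Module.finrank ℝ V)) (Fin (Module.finrank ℝ V)) ℝ :=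
    Matrix.of fun k i => b.repr (e k) i
  have hQ (k) : ∑ i, Q k i • b i = e k := b.sum_repr (e k)
  have hQP : Q * P = 1 := by
    ext k l
    have := congrArg (B (e l)) (hQ k)
    simp only [map_sum, map_smul, smul_eq_mul, he l k] at this
    simp only [Matrix.mul_apply, P, Matrix.of_apply, this, Matrix.one_apply, eq_comm]
  have hPQ : P * Q = 1 := mul_eq_one_comm.1 hQP
  have hgram : (Matrix.of fun i j => B (b i) (b j)) = P * P.transpose := by
    ext i j
    simp [Matrix.mul_apply, P, he.sum_mul hcard]
  have hinv : (P * P.transpose)⁻¹ = Q.transpose * Q := by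
    apply Matrix.inv_eq_right_inv
    rw [Matrix.mul_assoc, ← Matrix.mul_assoc P.transpose, ← Matrix.transpose_mul, hQP,
      Matrix.transpose_one, Matrix.one_mul, hPQ]
  change ∑ i, ∑ j, (Matrix.of fun i j => B (b i) (b j))⁻¹ i j • T (b i) (b j) = _
  rw [hgram, hinv]
  have hT (k : Fin (Module.finrank ℝ V)) :
      T (e k) (e k) = ∑ i, ∑ j, (Q k i * Q k j) • T (b i) (b j) := by
    rw [← hQ k]
    simp only [map_sum, map_smul, LinearMap.sum_apply, LinearMap.smul_apply, Finset.smul_sum,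
      smul_smul]
    rw [Finset.sum_comm]
    simp only [mul_comm]
  simp only [hT, Matrix.mul_apply, Matrix.transpose_apply, Finset.sum_smul]
  conv_rhs => rw [Finset.sum_comm]
  refine Finset.sum_congr rfl fun i _ => ?_
  conv_rhs => rw [Finset.sum_comm]

end IsOrthonormalFor

/-- Every unit vector is a prescribed member of some orthonormal basis. -/
theorem exists_isOrthonormalFor {B : V →ₗ[ℝ] V →ₗ[ℝ] ℝ} (hsymm : ∀ u v, B u v = B v u)
    (hpos : ∀ u, u ≠ 0 → 0 < B u u) {X : V} (hX : B X X = 1) (o : Fin (Module.finrank ℝ V)) :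
    ∃ e : Fin (Module.finrank ℝ V) → V, IsOrthonormalFor B e ∧ e o = X := by
  let core : InnerProductSpace.Core ℝ V :=
    { inner := fun u v => B u v
      conj_inner_symm := fun u v => hsymm v u
      re_inner_nonneg := fun u => by
        rcases eq_or_ne u 0 with rfl | h
        · simp
        · exact (hpos u h).le
      add_left := fun u v w => by simp
      smul_left := fun u v r => by simp
      definite := fun u hu => by
        by_contra h
        exact (hpos u h).ne' hu }
  let _ := core.toNormedAddCommGroup
  let _ : InnerProductSpace ℝ V := InnerProductSpace.ofCore core.toCore
  have hin (u v : V) : inner ℝ u v = B u v := rfl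
  have hX1 : ‖X‖ = 1 := by
    have := real_inner_self_eq_norm_sq X
    rw [hin, hX] at this
    nlinarith [norm_nonneg X]
  obtain ⟨e, he⟩ := Orthonormal.exists_orthonormalBasis_extension_of_card_eq (𝕜 := ℝ) (E := V)
    (ι := Fin (Module.finrank ℝ V)) (by simp) (v := fun _ => X) (s := {o}) (by
      refine ⟨fun i => hX1, fun i j hij => (hij (Subsingleton.elim i j)).elim⟩)
  exact ⟨e, fun i j => by rw [← hin]; exact orthonormal_iff_ite.1 e.orthonormal i j, he o rfl⟩

end InnerProducts

/-! ### The algebraic inequality -/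

/-- The inequality for a totally symmetric array `s`, the components of a Lagrangian second
fundamental form. With `x_k = s_{ook}` and the traces `t_k = ∑ s_{iik}`, what is left of the
right-hand side after discarding the `s_{oik}` with `i ≠ o`, `k ∉ {o, i}` and using the
Cauchy-Schwarz inequality on the `s_{iio}`, `i ≠ o`, is the sum of squares that stands on the left;
it determines the case of equality. -/
theorem sum_cubic_form_le {ι : Type*} [Fintype ι] [DecidableEq ι] (s : ι → ι → ι → ℝ)
    (h12 : ∀ i j k, s i j k = s j i k) (h23 : ∀ i j k, s i j k = s i k j)
    (hn : 2 ≤ Fintype.card ι) (o : ι) {n : ℝ} (hnc : n = Fintype.card ι) :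
    ∑ i, ∑ k, (s o o k * s i i k - s o i k ^ 2)
      + (2 * n * s o o o - (n + 1) * ∑ i, s i i o) ^ 2 / (4 * n * (n - 1))
      + ∑ k ∈ Finset.univ.erase o, ((4 * s o o k - ∑ i, s i i k) ^ 2 / 8
          + (n - 2) / (8 * n) * (∑ i, s i i k) ^ 2)
      ≤ (n - 1) / (4 * n) * ∑ k, (∑ i, s i i k) ^ 2 := by
  have hn2 : (2 : ℝ) ≤ n := by rw [hnc]; exact_mod_cast hn
  have hn0 : n ≠ 0 := by linarith
  have hn1 : n - 1 ≠ 0 := by linarith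
  set t : ι → ℝ := fun k => ∑ i, s i i k with ht
  have hcross : ∑ i, ∑ k, s o o k * s i i k = ∑ k, s o o k * t k := by
    rw [Finset.sum_comm]
    simp only [ht, Finset.mul_sum]
  -- For `i ≠ o` only the components `s o i o` and `s o i i` are kept.
  have hsq : ∑ k, s o o k ^ 2 + ∑ i ∈ Finset.univ.erase o, (s o o i ^ 2 + s i i o ^ 2)
      ≤ ∑ i, ∑ k, s o i k ^ 2 := by
    rw [← Finset.add_sum_erase _ (fun i => ∑ k, s o i k ^ 2) (Finset.mem_univ o)]
    gcongr with i hi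
    have hio : o ≠ i := (Finset.ne_of_mem_erase hi).symm
    calc s o o i ^ 2 + s i i o ^ 2 = ∑ k ∈ {o, i}, s o i k ^ 2 := by
          rw [Finset.sum_pair hio, h23 o o i, h12 o i i, h23 i o i]
      _ ≤ _ := Finset.sum_le_univ_sum_of_nonneg fun k => sq_nonneg _
  have hcs : (t o - s o o o) ^ 2 ≤ (n - 1) * ∑ i ∈ Finset.univ.erase o, s i i o ^ 2 := by
    have h1 : t o - s o o o = ∑ i ∈ Finset.univ.erase o, s i i o := by
      simp only [ht]
      rw [← Finset.add_sum_erase _ _ (Finset.mem_univ o)]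
      ring
    have h2 := sq_sum_le_card_mul_sum_sq (s := Finset.univ.erase o) (f := fun i => s i i o)
    rw [Finset.card_erase_of_mem (Finset.mem_univ o), Finset.card_univ,
      Nat.cast_sub (by omega), ← hnc, Nat.cast_one] at h2
    rwa [h1]
  have hcs' : (t o - s o o o) ^ 2 / (n - 1) ≤ ∑ i ∈ Finset.univ.erase o, s i i o ^ 2 := by
    rw [div_le_iff₀ (by linarith)]
    linarith
  have hk (k : ι) : (4 * s o o k - t k) ^ 2 / 8 + (n - 2) / (8 * n) * t k ^ 2 =
      (n - 1) / (4 * n) * t k ^ 2 - s o o k * t k + 2 * s o o k ^ 2 := by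
    field_simp
    ring
  have ho : (2 * n * s o o o - (n + 1) * t o) ^ 2 / (4 * n * (n - 1)) =
      (n - 1) / (4 * n) * t o ^ 2 - s o o o * t o + s o o o ^ 2
        + (t o - s o o o) ^ 2 / (n - 1) := by
    field_simp
    ring
  change _ + (2 * n * s o o o - (n + 1) * t o) ^ 2 / (4 * n * (n - 1))
      + ∑ k ∈ Finset.univ.erase o, ((4 * s o o k - t k) ^ 2 / 8
          + (n - 2) / (8 * n) * t k ^ 2) ≤ (n - 1) / (4 * n) * ∑ k, t k ^ 2
  simp only [Finset.sum_sub_distrib, hcross, hk, ho, Finset.sum_add_distrib] at hsq ⊢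
  rw [← Finset.add_sum_erase _ _ (Finset.mem_univ o)] at hsq
  rw [← Finset.add_sum_erase _ (fun k => s o o k * t k) (Finset.mem_univ o),
    ← Finset.add_sum_erase _ (fun k => t k ^ 2) (Finset.mem_univ o)]
  simp only [← Finset.mul_sum]
  linarith

/-! ### Lagrangian second fundamental forms at a point -/

section Lagrangian

variable {V W : Type*} [AddCommGroup V] [Module ℝ V] [AddCommGroup W] [Module ℝ W]

/-- The data at a point of a Lagrangian immersion with differential `L`: the ambient metric `g` and
complex structure `J`, and the second fundamental form `h`. The field `cubic`, together with the
symmetry of `h`, makes `g(h(u, v), J L w)` totally symmetric. -/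
structure IsLagrangianForm (g : W →ₗ[ℝ] W →ₗ[ℝ] ℝ) (J : W →ₗ[ℝ] W) (L : V →ₗ[ℝ] W)
    (h : V →ₗ[ℝ] V →ₗ[ℝ] W) : Prop where
  g_symm : ∀ u v, g u v = g v u
  g_pos : ∀ u, u ≠ 0 → 0 < g u u
  sq_eq_neg : ∀ v, J (J v) = -v
  hermitian : ∀ u v, g (J u) (J v) = g u v
  injective : Function.Injective L
  finrank_eq : Module.finrank ℝ W = 2 * Module.finrank ℝ V
  lagrangian : ∀ u v, g (J (L u)) (L v) = 0
  h_symm : ∀ u v, h u v = h v u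
  normal : ∀ u v w, g (h u v) (L w) = 0
  cubic : ∀ u v w, g (h u v) (J (L w)) = g (h u w) (J (L v))

namespace IsLagrangianForm

variable {g : W →ₗ[ℝ] W →ₗ[ℝ] ℝ} {J : W →ₗ[ℝ] W} {L : V →ₗ[ℝ] W} {h : V →ₗ[ℝ] V →ₗ[ℝ] W}

theorem induced_pos (H : IsLagrangianForm g J L h) (u : V) (hu : u ≠ 0) :
    0 < g.compl₁₂ L L u u :=
  H.g_pos _ (by simpa using H.injective.ne hu)

theorem induced_symm (H : IsLagrangianForm g J L h) (u v : V) :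
    g.compl₁₂ L L u v = g.compl₁₂ L L v u := H.g_symm _ _

variable {ι : Type*} [Fintype ι] [DecidableEq ι] {e : ι → V}

omit [Fintype ι] in
theorem isOrthonormalFor_sum (H : IsLagrangianForm g J L h)
    (he : IsOrthonormalFor (g.compl₁₂ L L) e) :
    IsOrthonormalFor g (Sum.elim (fun i => L (e i)) fun i => J (L (e i))) := by
  have he' (i j) : g (L (e i)) (L (e j)) = if i = j then 1 else 0 := he i j
  rintro (i | i) (j | j)
  · simpa using he' i j
  · simpa using (H.g_symm _ _).trans (H.lagrangian _ _)
  · simpa using H.lagrangian _ _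
  · simpa [H.hermitian] using he' i j

variable [FiniteDimensional ℝ W]

/-- The images under `L` and `J L` of an orthonormal basis form an orthonormal basis. -/
theorem sum_mul_add_sum_mul (H : IsLagrangianForm g J L h)
    (he : IsOrthonormalFor (g.compl₁₂ L L) e) (hcard : Fintype.card ι = Module.finrank ℝ V)
    (u v : W) :
    ∑ i, g (L (e i)) u * g (L (e i)) v + ∑ i, g (J (L (e i))) u * g (J (L (e i))) v = g u v := by
  have := (H.isOrthonormalFor_sum he).sum_mul (by simp [H.finrank_eq, hcard]; omega) u v
  simpa using this

/-- The vectors `J L e_i` form an orthonormal basis of the normal space, where `h` takes its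
values. -/
theorem sum_mul_normal (H : IsLagrangianForm g J L h)
    (he : IsOrthonormalFor (g.compl₁₂ L L) e) (hcard : Fintype.card ι = Module.finrank ℝ V)
    (u v : V) (w : W) :
    ∑ i, g (h u v) (J (L (e i))) * g w (J (L (e i))) = g (h u v) w := by
  rw [← H.sum_mul_add_sum_mul he hcard]
  simp [H.g_symm _ (h u v), H.normal, H.g_symm _ w]

theorem sum_smul_normal (H : IsLagrangianForm g J L h)
    (he : IsOrthonormalFor (g.compl₁₂ L L) e) (hcard : Fintype.card ι = Module.finrank ℝ V)
    (u v : V) : ∑ i, g (h u v) (J (L (e i))) • J (L (e i)) = h u v := by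
  have := (H.isOrthonormalFor_sum he).sum_smul (by simp [H.finrank_eq, hcard]; omega) (h u v)
  simpa [H.g_symm _ (h u v), H.normal] using this

omit [DecidableEq ι] [FiniteDimensional ℝ W] in
theorem trace_apply (v : V) : g (∑ i, h (e i) (e i)) (J (L v)) =
    ∑ i, g (h (e i) (e i)) (J (L v)) := by
  rw [map_sum, LinearMap.sum_apply]

/-- `sum_cubic_form_le` in invariant terms, for an orthonormal basis containing `e o`. Here `m` is
the trace of `h`, so that `m = n H` for the mean curvature vector `H`. -/
theorem sum_add_squares_le (H : IsLagrangianForm g J L h)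
    (he : IsOrthonormalFor (g.compl₁₂ L L) e) (hcard : Fintype.card ι = Module.finrank ℝ V)
    (hn : 2 ≤ Fintype.card ι) (o : ι) {n : ℝ} (hnc : n = Fintype.card ι) {m : W}
    (hm : m = ∑ i, h (e i) (e i)) :
    ∑ i, (g (h (e o) (e o)) (h (e i) (e i)) - g (h (e o) (e i)) (h (e o) (e i)))
      + (2 * n * g (h (e o) (e o)) (J (L (e o))) - (n + 1) * g m (J (L (e o)))) ^ 2
          / (4 * n * (n - 1))
      + ∑ k ∈ Finset.univ.erase o,
          ((4 * g (h (e o) (e o)) (J (L (e k))) - g m (J (L (e k)))) ^ 2 / 8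
            + (n - 2) / (8 * n) * g m (J (L (e k))) ^ 2)
      ≤ (n - 1) / (4 * n) * g m m := by
  let s : ι → ι → ι → ℝ := fun i j k => g (h (e i) (e j)) (J (L (e k)))
  have h12 (i j k) : s i j k = s j i k := by simp only [s, H.h_symm (e i)]
  have h23 (i j k) : s i j k = s i k j := H.cubic _ _ _
  subst hm
  simp only [trace_apply]
  convert sum_cubic_form_le s h12 h23 hn o hnc using 3
  · refine Finset.sum_congr rfl fun i _ => ?_
    rw [← H.sum_mul_normal he hcard, ← H.sum_mul_normal he hcard, ← Finset.sum_sub_distrib]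
    refine Finset.sum_congr rfl fun k _ => ?_
    simp only [s]
    ring
  · conv_lhs => rw [map_sum]
    rw [Finset.sum_congr rfl fun i _ => (H.g_symm (∑ i, h (e i) (e i)) (h (e i) (e i))).trans
      (H.sum_mul_normal he hcard (e i) (e i) _).symm]
    rw [Finset.sum_comm]
    refine Finset.sum_congr rfl fun k _ => ?_
    rw [← Finset.sum_mul, trace_apply, sq]

section Trace

variable [FiniteDimensional ℝ V]

/-- The trace `∑ h(e_i, e_i)` of the second fundamental form. -/
def traceForm (g : W →ₗ[ℝ] W →ₗ[ℝ] ℝ) (L : V →ₗ[ℝ] W) (h : V →ₗ[ℝ] V →ₗ[ℝ] W) : W :=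
  metricTrace (fun u v => g (L u) (L v)) fun u v => h u v

/-- The contribution `∑ (g(h(X, X), h(e_i, e_i)) - |h(X, e_i)|²)` of the second fundamental form
to the Ricci curvature. -/
def extrinsicRicci (g : W →ₗ[ℝ] W →ₗ[ℝ] ℝ) (L : V →ₗ[ℝ] W) (h : V →ₗ[ℝ] V →ₗ[ℝ] W) (X : V) : ℝ :=
  metricTrace (fun u v => g (L u) (L v)) fun u v =>
    g (h X X) (h u v) - g (h X u) (h X v)

omit [FiniteDimensional ℝ W] in
theorem traceForm_eq {e : Fin (Module.finrank ℝ V) → V}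
    (he : IsOrthonormalFor (g.compl₁₂ L L) e) : traceForm g L h = ∑ i, h (e i) (e i) :=
  he.metricTrace_eq h

omit [FiniteDimensional ℝ W] in
theorem extrinsicRicci_eq {e : Fin (Module.finrank ℝ V) → V}
    (he : IsOrthonormalFor (g.compl₁₂ L L) e) (X : V) :
    extrinsicRicci g L h X =
      ∑ i, (g (h X X) (h (e i) (e i)) - g (h X (e i)) (h X (e i))) :=
  he.metricTrace_eq (h.compr₂ (g (h X X)) - g.compl₁₂ (h X) (h X))

theorem extrinsicRicci_le (H : IsLagrangianForm g J L h) (hn : 2 ≤ Module.finrank ℝ V) {n : ℝ}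
    (hnc : n = Module.finrank ℝ V) {X : V} (hX : g (L X) (L X) = 1) :
    extrinsicRicci g L h X ≤ (n - 1) / (4 * n) * g (traceForm g L h) (traceForm g L h) := by
  obtain ⟨e, he, rfl⟩ := exists_isOrthonormalFor H.induced_symm H.induced_pos hX ⟨0, by omega⟩
  have key := H.sum_add_squares_le he (by simp) (by simpa using hn) ⟨0, by omega⟩ (n := n)
    (by simpa using hnc) (traceForm_eq he)
  rw [extrinsicRicci_eq he]
  have hn2 : (2 : ℝ) ≤ n := by rw [hnc]; exact_mod_cast hn
  have h1 : 0 ≤ n - 1 := by linarith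
  have h2 : 0 ≤ n - 2 := by linarith
  have h3 : 0 ≤ n := by linarith
  refine le_trans ?_ key
  rw [add_assoc]
  exact le_add_of_nonneg_right (by positivity)

/-- The vanishing of the squares in `sum_add_squares_le` in the case of equality at `e o`. -/
theorem eq_of_extrinsicRicci_eq (H : IsLagrangianForm g J L h) (hn : 2 ≤ Module.finrank ℝ V)
    {n : ℝ} (hnc : n = Module.finrank ℝ V) {e : Fin (Module.finrank ℝ V) → V}
    (he : IsOrthonormalFor (g.compl₁₂ L L) e) {o : Fin (Module.finrank ℝ V)}
    (heq : extrinsicRicci g L h (e o) =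
      (n - 1) / (4 * n) * g (traceForm g L h) (traceForm g L h)) :
    2 * n * g (h (e o) (e o)) (J (L (e o))) = (n + 1) * g (traceForm g L h) (J (L (e o))) ∧
    ∀ k, k ≠ o → 4 * g (h (e o) (e o)) (J (L (e k))) = g (traceForm g L h) (J (L (e k))) ∧
      (n - 2) * g (traceForm g L h) (J (L (e k))) = 0 := by
  have key := H.sum_add_squares_le he (by simp) (by simpa using hn) o (n := n)
    (by simpa using hnc) (traceForm_eq he)
  rw [extrinsicRicci_eq he] at heq
  rw [heq] at key
  have hn2 : (2 : ℝ) ≤ n := by rw [hnc]; exact_mod_cast hn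
  have h1 : 0 < n - 1 := by linarith
  have h2 : 0 ≤ n - 2 := by linarith
  have h3 : 0 < n := by linarith
  set m := traceForm g L h
  have hpos (k) : 0 ≤ (4 * g (h (e o) (e o)) (J (L (e k))) - g m (J (L (e k)))) ^ 2 / 8
            + (n - 2) / (8 * n) * g m (J (L (e k))) ^ 2 := by positivity
  have hs0 := Finset.sum_nonneg fun k (_ : k ∈ Finset.univ.erase o) => hpos k
  have hq0 : 0 ≤ (2 * n * g (h (e o) (e o)) (J (L (e o))) - (n + 1) * g m (J (L (e o)))) ^ 2
          / (4 * n * (n - 1)) := by positivity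
  constructor
  · have hz : (2 * n * g (h (e o) (e o)) (J (L (e o))) - (n + 1) * g m (J (L (e o)))) ^ 2
          / (4 * n * (n - 1)) = 0 := by linarith
    rw [div_eq_zero_iff, or_iff_left (by positivity), sq_eq_zero_iff, sub_eq_zero] at hz
    exact hz
  · intro k hk
    have hz := (Finset.sum_eq_zero_iff_of_nonneg
      (fun k (_ : k ∈ Finset.univ.erase o) => hpos k)).1 (by linarith) k (by simp [hk])
    have ha : 0 ≤ (4 * g (h (e o) (e o)) (J (L (e k))) - g m (J (L (e k)))) ^ 2 / 8 := by
      positivity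
    have hb : 0 ≤ (n - 2) / (8 * n) * g m (J (L (e k))) ^ 2 := by positivity
    constructor
    · have : (4 * g (h (e o) (e o)) (J (L (e k))) - g m (J (L (e k)))) ^ 2 = 0 := by linarith
      rwa [sq_eq_zero_iff, sub_eq_zero] at this
    · have hc : (n - 2) / (8 * n) * g m (J (L (e k))) ^ 2 = 0 := by linarith
      rcases mul_eq_zero.1 hc with hc | hc
      · rw [div_eq_zero_iff, or_iff_left (by positivity)] at hc
        rw [hc, zero_mul]
      · rw [pow_eq_zero_iff (by norm_num)] at hc
        rw [hc, mul_zero]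

omit [FiniteDimensional ℝ V] [FiniteDimensional ℝ W] in
theorem exists_unit_smul (H : IsLagrangianForm g J L h) {v : V} (hv : v ≠ 0) :
    ∃ (r : ℝ) (X : V), g (L X) (L X) = 1 ∧ v = r • X := by
  have hp : 0 < g (L v) (L v) := H.induced_pos v hv
  have hs := Real.sqrt_pos.2 hp
  refine ⟨√(g (L v) (L v)), (√(g (L v) (L v)))⁻¹ • v, ?_, ?_⟩
  · simp only [map_smul, LinearMap.smul_apply, smul_eq_mul]
    rw [← mul_assoc, ← mul_inv, Real.mul_self_sqrt hp.le, inv_mul_cancel₀ hp.ne']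
  · rw [smul_smul, mul_inv_cancel₀ hs.ne', one_smul]

/-- In dimension at least three, equality in all directions forces `h = 0`: the last squares make the
trace of `h` orthogonal to `J L Y` for every unit vector `Y`, so that it vanishes; the other squares
then give `h(X, X) = 0`. -/
theorem eq_zero_of_extrinsicRicci_eq (H : IsLagrangianForm g J L h)
    (hn : 2 < Module.finrank ℝ V) {n : ℝ} (hnc : n = Module.finrank ℝ V)
    (heq : ∀ X, g (L X) (L X) = 1 → extrinsicRicci g L h X =
      (n - 1) / (4 * n) * g (traceForm g L h) (traceForm g L h)) (u v : V) : h u v = 0 := by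
  have hn2 : (2 : ℝ) < n := by rw [hnc]; exact_mod_cast hn
  -- `X` is not the distinguished vector of the equality used here, but a vector orthogonal to it.
  have htr (X : V) (hX : g (L X) (L X) = 1) : g (traceForm g L h) (J (L X)) = 0 := by
    obtain ⟨e, he, rfl⟩ := exists_isOrthonormalFor H.induced_symm H.induced_pos hX ⟨0, by omega⟩
    have h1 : g (L (e ⟨1, by omega⟩)) (L (e ⟨1, by omega⟩)) = 1 := by
      simpa using he ⟨1, by omega⟩ ⟨1, by omega⟩
    have h2 := ((H.eq_of_extrinsicRicci_eq hn.le hnc he (heq _ h1)).2 ⟨0, by omega⟩ (by simp)).2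
    exact (mul_eq_zero.1 h2).resolve_left (by linarith)
  have hunit (X : V) (hX : g (L X) (L X) = 1) : h X X = 0 := by
    obtain ⟨e, he, rfl⟩ := exists_isOrthonormalFor H.induced_symm H.induced_pos hX ⟨0, by omega⟩
    have h2 := H.eq_of_extrinsicRicci_eq hn.le hnc he (heq _ hX)
    rw [← H.sum_smul_normal he (by simp)]
    refine Finset.sum_eq_zero fun k _ => ?_
    have hk : g (L (e k)) (L (e k)) = 1 := by simpa using he k k
    rcases eq_or_ne k ⟨0, by omega⟩ with rfl | hne
    · have := h2.1
      rw [htr _ hX, mul_zero] at this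
      rw [(mul_eq_zero.1 this).resolve_left (by linarith), zero_smul]
    · have := (h2.2 k hne).1
      rw [htr _ hk] at this
      rw [(mul_eq_zero.1 this).resolve_left (by norm_num), zero_smul]
  have hdiag (v : V) : h v v = 0 := by
    rcases eq_or_ne v 0 with rfl | hv
    · simp
    · obtain ⟨r, X, hX, rfl⟩ := H.exists_unit_smul hv
      simp [hunit X hX]
  have := hdiag (u + v)
  simp only [map_add, LinearMap.add_apply, hdiag, zero_add, add_zero, H.h_symm v u] at this
  rw [← two_smul ℝ] at this
  exact (smul_eq_zero.1 this).resolve_left (by norm_num)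

/-- The form `h` is `H`-umbilical with the numbers `lam` and `mu`, with `e i₀` as the distinguished
vector of an orthonormal basis. -/
def IsHUmbilical (g : W →ₗ[ℝ] W →ₗ[ℝ] ℝ) (J : W →ₗ[ℝ] W) (L : V →ₗ[ℝ] W)
    (h : V →ₗ[ℝ] V →ₗ[ℝ] W) (lam mu : ℝ) : Prop :=
  ∃ (e : Fin (Module.finrank ℝ V) → V) (i₀ : Fin (Module.finrank ℝ V)),
    (∀ i j, g (L (e i)) (L (e j)) = if i = j then 1 else 0) ∧
    h (e i₀) (e i₀) = lam • J (L (e i₀)) ∧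
    (∀ j, j ≠ i₀ → h (e j) (e j) = mu • J (L (e i₀))) ∧
    (∀ j, j ≠ i₀ → h (e i₀) (e j) = mu • J (L (e j))) ∧
    (∀ j k, j ≠ i₀ → k ≠ i₀ → j ≠ k → h (e j) (e k) = 0)

omit [FiniteDimensional ℝ V] in
theorem exists_univ_eq_pair (hn : Module.finrank ℝ V = 2) (o : Fin (Module.finrank ℝ V)) :
    ∃ k, k ≠ o ∧ (Finset.univ : Finset (Fin (Module.finrank ℝ V))) = {o, k} := by
  have hcard : (Finset.univ : Finset (Fin (Module.finrank ℝ V))).card = 2 := by simpa using hn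
  obtain ⟨x, y, hxy, he⟩ := Finset.card_eq_two.1 hcard
  have ho : o ∈ ({x, y} : Finset _) := he ▸ Finset.mem_univ o
  rcases Finset.mem_insert.1 ho with rfl | ho
  · exact ⟨y, hxy.symm, he⟩
  · obtain rfl := Finset.mem_singleton.1 ho
    exact ⟨x, hxy, he.trans (Finset.pair_comm _ _)⟩

/-- On a surface, equality in all directions is the `H`-umbilical case: take an orthonormal basis
`e o`, `e k` such that `J L (e k)` is orthogonal to the trace of `h`. -/
theorem isHUmbilical_of_extrinsicRicci_eq (H : IsLagrangianForm g J L h)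
    (hn : Module.finrank ℝ V = 2) {n : ℝ} (hnc : n = Module.finrank ℝ V)
    (heq : ∀ X, g (L X) (L X) = 1 → extrinsicRicci g L h X =
      (n - 1) / (4 * n) * g (traceForm g L h) (traceForm g L h)) :
    ∃ lam mu, IsHUmbilical g J L h lam mu ∧ lam = 3 * mu := by
  have hn2 : n = 2 := by rw [hnc, hn]; norm_num
  obtain ⟨v, hv, hv0⟩ := Submodule.exists_mem_ne_zero_of_ne_bot
    (LinearMap.ker_ne_bot_of_finrank_lt (f := (g (traceForm g L h)).comp (J.comp L))
      (by simp [hn]))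
  obtain ⟨r, Y, hY, rfl⟩ := H.exists_unit_smul hv0
  have hr : r ≠ 0 := fun hr => hv0 (by simp [hr])
  have hmY : g (traceForm g L h) (J (L Y)) = 0 := by
    simpa [hr] using hv
  obtain ⟨e, he, rfl⟩ := exists_isOrthonormalFor H.induced_symm H.induced_pos hY ⟨0, by omega⟩
  generalize (⟨0, by omega⟩ : Fin (Module.finrank ℝ V)) = k at *
  obtain ⟨o, hok, huniv⟩ := exists_univ_eq_pair hn k
  have ho : g (L (e o)) (L (e o)) = 1 := by simpa using he o o
  have h1 := H.eq_of_extrinsicRicci_eq hn.ge hnc he (heq _ ho)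
  have h2 := H.eq_of_extrinsicRicci_eq hn.ge hnc he (heq _ hY)
  obtain ⟨a1, a2⟩ := h1
  have a2 := (a2 k hok.symm).1
  have b1 := h2.1
  have htr : g (traceForm g L h) (J (L (e o))) =
      g (h (e k) (e k)) (J (L (e o))) + g (h (e o) (e o)) (J (L (e o))) := by
    rw [traceForm_eq he, trace_apply, huniv, Finset.sum_pair hok.symm]
  have hexp (u v : V) := H.sum_smul_normal he (by simp) u v
  simp only [huniv, Finset.sum_pair hok.symm] at hexp
  rw [hmY] at a2 b1
  have c1 : g (h (e k) (e k)) (J (L (e k))) = 0 := by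
    rw [hn2] at b1; linarith
  have c2 : g (h (e o) (e o)) (J (L (e k))) = 0 := by linarith
  have c3 : g (h (e o) (e o)) (J (L (e o))) = 3 * g (h (e k) (e k)) (J (L (e o))) := by
    rw [hn2] at a1; linarith
  have hj (j) (hj : j ≠ o) : j = k := by
    have : j ∈ ({k, o} : Finset _) := huniv ▸ Finset.mem_univ j
    simpa [hj] using this
  refine ⟨_, g (h (e k) (e k)) (J (L (e o))), ⟨e, o, he, ?_, ?_, ?_, ?_⟩, rfl⟩
  · rw [← hexp, c2, c3, zero_smul, zero_add]
  · intro j hjo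
    rw [hj j hjo]
    conv_lhs => rw [← hexp, c1, zero_smul, zero_add]
  · intro j hjo
    rw [hj j hjo, ← hexp (e o) (e k), H.cubic (e o) (e k) (e o), c2, H.h_symm (e o),
      H.cubic (e k) (e o), zero_smul, add_zero]
  · intro i j hi hj' hij
    exact absurd ((hj i hi).trans (hj j hj').symm) hij

omit [FiniteDimensional ℝ W] in
theorem extrinsicRicci_eq_of_isHUmbilical (H : IsLagrangianForm g J L h)
    (hn : Module.finrank ℝ V = 2) {n : ℝ} (hnc : n = Module.finrank ℝ V) {mu : ℝ}
    (hh : IsHUmbilical g J L h (3 * mu) mu) {X : V} (hX : g (L X) (L X) = 1) :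
    extrinsicRicci g L h X =
      (n - 1) / (4 * n) * g (traceForm g L h) (traceForm g L h) := by
  have hn2 : n = 2 := by rw [hnc, hn]; norm_num
  obtain ⟨e, o, he, h1, h2, h3, -⟩ := hh
  have he' : IsOrthonormalFor (g.compl₁₂ L L) e := he
  obtain ⟨k, hko, huniv⟩ := exists_univ_eq_pair hn o
  have h2 := h2 k hko
  have h3 := h3 k hko
  have h3' : h (e k) (e o) = mu • J (L (e k)) := by rw [H.h_symm, h3]
  obtain ⟨x, y, rfl⟩ : ∃ x y : ℝ, X = x • e o + y • e k := by
    have := he'.sum_smul (by simp) X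
    rw [huniv, Finset.sum_pair hko.symm] at this
    exact ⟨_, _, this.symm⟩
  have hoo : g (L (e o)) (L (e o)) = 1 := by simpa using he o o
  have hkk : g (L (e k)) (L (e k)) = 1 := by simpa using he k k
  have hok : g (L (e o)) (L (e k)) = 0 := by simpa [hko.symm] using he o k
  have hko' : g (L (e k)) (L (e o)) = 0 := by simpa [hko] using he k o
  rw [extrinsicRicci_eq he', traceForm_eq he', huniv, Finset.sum_pair hko.symm,
    Finset.sum_pair hko.symm, hn2]
  simp only [map_add, map_smul, LinearMap.add_apply, LinearMap.smul_apply, smul_eq_mul, hoo, hkk,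
    hok, hko', h1, h2, h3, h3', H.hermitian] at hX ⊢
  have hxy : y ^ 2 = 1 - x ^ 2 := by linarith
  ring_nf
  simp only [hxy]
  ring

end Trace

end IsLagrangianForm

end Lagrangian

/-! ### The ambient curvature -/

namespace IsLagrangianForm

variable {V W : Type*} [AddCommGroup V] [Module ℝ V] [AddCommGroup W] [Module ℝ W]
  [FiniteDimensional ℝ W]
  {g : W →ₗ[ℝ] W →ₗ[ℝ] ℝ} {J : W →ₗ[ℝ] W} {L : V →ₗ[ℝ] W} {h : V →ₗ[ℝ] V →ₗ[ℝ] W}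
  {ι : Type*} [Fintype ι] [DecidableEq ι] {e : ι → V}

/-- The sum over an orthonormal basis of the ambient curvatures `R(L X, L e_i, L e_i, L X)`. The
constant `1` next to `b` is `|ξ|²`, as `L e_i` and `J L e_i` together form an orthonormal basis of
the ambient space. -/
theorem sum_curvature_eq (H : IsLagrangianForm g J L h)
    (he : IsOrthonormalFor (g.compl₁₂ L L) e) (hcard : Fintype.card ι = Module.finrank ℝ V)
    [FiniteDimensional ℝ V]
    {n : ℝ} (hnc : n = Fintype.card ι) {ξ : W} (hξ : g ξ ξ = 1) {X Y : V}
    (hX : g (L X) (L X) = 1)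
    (hY : ∀ v, g (L Y) (L v) = g ξ (L X) * g (J ξ) (L v) - g (J ξ) (L X) * g ξ (L v))
    (a b c : ℝ) :
    ∑ i, (a * tensorPi (fun u v => g u v) J (L X) (L (e i)) (L (e i)) (L X)
      + b * tensorPhi (fun u v => g u v) J ξ (L X) (L (e i)) (L (e i)) (L X)
      + c * tensorPsi (fun u v => g u v) J ξ (L X) (L (e i)) (L (e i)) (L X)) =
    (n - 1) / 4 * a + 1 / 8 * ((n - 2) * (g ξ (L X) ^ 2 + g (J ξ) (L X) ^ 2) + 1) * b
      + g (L Y) (L Y) * c := by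
  have hee (i) : g (L (e i)) (L (e i)) = 1 := by simpa using he i i
  have hskew (u v : W) : g (J u) v = -g u (J v) := by
    rw [← H.hermitian u (J v), H.sq_eq_neg]; simp
  have p1 : ∑ i, g (L X) (L (e i)) ^ 2 = 1 := by
    have := he.sum_mul hcard X X
    simp only [LinearMap.compl₁₂_apply, hX] at this
    simpa only [H.g_symm (L X), sq] using this
  have pcross (w : W) : ∑ i, g (L X) (L (e i)) * g w (L (e i)) = g w (L X) := by
    have := congrArg (fun v => g w (L v)) (he.sum_smul hcard X)
    simpa [map_sum, H.g_symm (L (e _)) (L X)] using this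
  have pξ : ∑ i, (g ξ (L (e i)) ^ 2 + g (J ξ) (L (e i)) ^ 2) = 1 := by
    rw [← hξ, ← H.sum_mul_add_sum_mul he hcard, Finset.sum_add_distrib]
    simp only [hskew, H.g_symm (L (e _)) ξ, H.g_symm (L (e _)) (J ξ), sq, neg_mul_neg]
  have pY : ∑ i, g (L Y) (L (e i)) ^ 2 = g (L Y) (L Y) := by
    have := he.sum_mul hcard Y Y
    simp only [LinearMap.compl₁₂_apply] at this
    simpa only [H.g_symm (L Y) (L (e _)), sq] using this
  have hcard' : ∑ i : ι, (1 : ℝ) = n := by simp [hnc]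
  have hi (i) : a * tensorPi (fun u v => g u v) J (L X) (L (e i)) (L (e i)) (L X)
      + b * tensorPhi (fun u v => g u v) J ξ (L X) (L (e i)) (L (e i)) (L X)
      + c * tensorPsi (fun u v => g u v) J ξ (L X) (L (e i)) (L (e i)) (L X) =
      a / 4 * (1 - g (L X) (L (e i)) ^ 2)
      + b / 8 * ((g ξ (L X) ^ 2 + g (J ξ) (L X) ^ 2) * 1
        - 2 * g ξ (L X) * (g (L X) (L (e i)) * g ξ (L (e i)))
        - 2 * g (J ξ) (L X) * (g (L X) (L (e i)) * g (J ξ) (L (e i)))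
        + (g ξ (L (e i)) ^ 2 + g (J ξ) (L (e i)) ^ 2))
      + c * g (L Y) (L (e i)) ^ 2 := by
    simp only [tensorPi, tensorPhi, tensorPsi, H.lagrangian, hee, hX, hY,
      H.g_symm (L (e i)) (L X)]
    ring
  simp only [hi, Finset.sum_add_distrib, ← Finset.mul_sum, Finset.sum_sub_distrib, p1, pcross,
    pY, hcard']
  rw [← Finset.sum_add_distrib, pξ]
  ring

end IsLagrangianForm

/-! ### Metrics and differentials in charts -/

section Charts

variable {E : Type*} [NormedAddCommGroup E] [NormedSpace ℝ E]
  {M : Type*} [TopologicalSpace M] [ChartedSpace E M] [IsManifold 𝓘(ℝ, E) ∞ M]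

theorem frameAt_coordsAt {p q : M} (hq : q ∈ (extChartAt 𝓘(ℝ, E) p).source)
    (v : TangentSpace 𝓘(ℝ, E) q) : frameAt p q (coordsAt p q v) = v :=
  (trivializationAt E (TangentSpace 𝓘(ℝ, E)) p).symmL_continuousLinearMapAt
    (by simpa using hq) v

theorem coordsAt_frameAt {p q : M} (hq : q ∈ (extChartAt 𝓘(ℝ, E) p).source) (u : E) :
    coordsAt p q (frameAt p q u) = u :=
  (trivializationAt E (TangentSpace 𝓘(ℝ, E)) p).continuousLinearMapAt_symmL
    (by simpa using hq) u

theorem metricCoord_apply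
    (g : ∀ x : M, TangentSpace 𝓘(ℝ, E) x →L[ℝ] TangentSpace 𝓘(ℝ, E) x →L[ℝ] ℝ) (p : M)
    (y : E) (u v : E) :
    metricCoord g p y u v = g ((extChartAt 𝓘(ℝ, E) p).symm y)
      (frameAt p ((extChartAt 𝓘(ℝ, E) p).symm y) u)
      (frameAt p ((extChartAt 𝓘(ℝ, E) p).symm y) v) := rfl

theorem metricCoord_extChartAt
    (g : ∀ x : M, TangentSpace 𝓘(ℝ, E) x →L[ℝ] TangentSpace 𝓘(ℝ, E) x →L[ℝ] ℝ) {p q : M}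
    (hq : q ∈ (extChartAt 𝓘(ℝ, E) p).source) (u v : E) :
    metricCoord g p (extChartAt 𝓘(ℝ, E) p q) u v = g q (frameAt p q u) (frameAt p q v) := by
  rw [metricCoord_apply, (extChartAt 𝓘(ℝ, E) p).left_inv hq]

theorem frameAt_endoCoord_extChartAt
    (J : ∀ x : M, TangentSpace 𝓘(ℝ, E) x →L[ℝ] TangentSpace 𝓘(ℝ, E) x) {p q : M}
    (hq : q ∈ (extChartAt 𝓘(ℝ, E) p).source) (u : E) :
    frameAt p q (endoCoord J p (extChartAt 𝓘(ℝ, E) p q) u) = J q (frameAt p q u) := by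
  have : endoCoord J p (extChartAt 𝓘(ℝ, E) p q) u = coordsAt p q (J q (frameAt p q u)) := by
    change coordsAt p ((extChartAt 𝓘(ℝ, E) p).symm _) (J ((extChartAt 𝓘(ℝ, E) p).symm _)
      (frameAt p ((extChartAt 𝓘(ℝ, E) p).symm _) u)) = _
    rw [(extChartAt 𝓘(ℝ, E) p).left_inv hq]
  rw [this, frameAt_coordsAt hq]

theorem contMDiffOn_frameAt (p : M) (u : E) :
    ContMDiffOn 𝓘(ℝ, E) (𝓘(ℝ, E).prod 𝓘(ℝ, E)) ∞
      (fun q => TotalSpace.mk' E (E := fun y : M => TangentSpace 𝓘(ℝ, E) y) q (frameAt p q u))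
      (extChartAt 𝓘(ℝ, E) p).source := by
  have := (Trivialization.contMDiffOn_section_baseSet_iff (n := ∞) (IB := 𝓘(ℝ, E))
    (trivializationAt E (TangentSpace 𝓘(ℝ, E) : M → Type _) p)
    (s := fun q => frameAt p q u)).2 (by
      refine (contMDiffOn_const (c := u)).congr fun q hq => ?_
      have h1 := coordsAt_frameAt (p := p) (q := q) (by simpa using hq) u
      rw [coordsAt, Trivialization.continuousLinearMapAt_apply,
        Trivialization.linearMapAt_apply, if_pos hq] at h1
      exact h1)
  simpa using this

theorem contDiffOn_metricCoord [FiniteDimensional ℝ E]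
    (g : ContMDiffRiemannianMetric 𝓘(ℝ, E) ∞ E (fun x : M => TangentSpace 𝓘(ℝ, E) x)) (p : M) :
    ContDiffOn ℝ ∞ (metricCoord g.inner p) (extChartAt 𝓘(ℝ, E) p).target := by
  rw [contDiffOn_clm_apply]
  intro u
  rw [contDiffOn_clm_apply]
  intro v
  have h1 : ContMDiffOn 𝓘(ℝ, E) (𝓘(ℝ, E).prod 𝓘(ℝ)) ∞
      (fun q => TotalSpace.mk' ℝ (E := Bundle.Trivial M ℝ) q
        (g.inner q (frameAt p q u) (frameAt p q v))) (extChartAt 𝓘(ℝ, E) p).source := by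
    apply ContMDiffOn.clm_bundle_apply₂ (F₁ := E) (F₂ := E)
    · exact g.contMDiff.contMDiffOn
    · exact contMDiffOn_frameAt p u
    · exact contMDiffOn_frameAt p v
  have h2 : ContMDiffOn 𝓘(ℝ, E) 𝓘(ℝ) ∞
      (fun q => g.inner q (frameAt p q u) (frameAt p q v)) (extChartAt 𝓘(ℝ, E) p).source :=
    fun q hq => (contMDiffWithinAt_totalSpace.1 (h1 q hq)).2
  exact (h2.comp (contMDiffOn_extChartAt_symm p)
    (extChartAt 𝓘(ℝ, E) p).mapsTo_symm).contDiffOn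

theorem contDiffOn_endoCoord [FiniteDimensional ℝ E]
    {J : ∀ x : M, TangentSpace 𝓘(ℝ, E) x →L[ℝ] TangentSpace 𝓘(ℝ, E) x}
    (hJ : ContMDiff 𝓘(ℝ, E) (𝓘(ℝ, E).prod 𝓘(ℝ, E →L[ℝ] E)) ∞
    (fun x => TotalSpace.mk' (E →L[ℝ] E)
      (E := fun x : M => TangentSpace 𝓘(ℝ, E) x →L[ℝ] TangentSpace 𝓘(ℝ, E) x) x (J x))) (p : M) :
    ContDiffOn ℝ ∞ (endoCoord J p) (extChartAt 𝓘(ℝ, E) p).target := by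
  rw [contDiffOn_clm_apply]
  intro u
  have h1 : ContMDiffOn 𝓘(ℝ, E) (𝓘(ℝ, E).prod 𝓘(ℝ, E)) ∞
      (fun q => TotalSpace.mk' E (E := fun y : M => TangentSpace 𝓘(ℝ, E) y) q
        (J q (frameAt p q u))) (extChartAt 𝓘(ℝ, E) p).source := by
    apply ContMDiffOn.clm_bundle_apply (F₁ := E)
    · exact hJ.contMDiffOn
    · exact contMDiffOn_frameAt p u
  have h2 : ContMDiffOn 𝓘(ℝ, E) 𝓘(ℝ, E) ∞
      (fun q => coordsAt p q (J q (frameAt p q u))) (extChartAt 𝓘(ℝ, E) p).source := by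
    have := (Trivialization.contMDiffOn_section_iff (n := ∞) (IB := 𝓘(ℝ, E))
      (trivializationAt E (TangentSpace 𝓘(ℝ, E) : M → Type _) p) (a := (extChartAt 𝓘(ℝ, E) p).source)
      (s := fun q => J q (frameAt p q u)) (isOpen_extChartAt_source p) (by simp)).1 h1
    refine this.congr fun q hq => ?_
    rw [coordsAt, Trivialization.continuousLinearMapAt_apply,
        Trivialization.linearMapAt_apply, if_pos (by simpa using hq)]
  exact (h2.comp (contMDiffOn_extChartAt_symm p)
    (extChartAt 𝓘(ℝ, E) p).mapsTo_symm).contDiffOn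

theorem isMetricNear_metricCoord [FiniteDimensional ℝ E]
    (g : ContMDiffRiemannianMetric 𝓘(ℝ, E) ∞ E (fun x : M => TangentSpace 𝓘(ℝ, E) x)) (p : M)
    {y : E} (hy : y ∈ (extChartAt 𝓘(ℝ, E) p).target) : IsMetricNear (metricCoord g.inner p) y := by
  have hnhds := (isOpen_extChartAt_target (I := 𝓘(ℝ, E)) p).mem_nhds hy
  refine ⟨contDiffAt_infty.1 ((contDiffOn_metricCoord g p).contDiffAt hnhds) 2, ?_, ?_⟩
  · exact Filter.Eventually.of_forall fun z u v => g.symm _ _ _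
  · filter_upwards [hnhds] with z hz u hu
    refine g.pos _ _ fun h0 => hu ?_
    have : coordsAt p ((extChartAt 𝓘(ℝ, E) p).symm z)
        (frameAt p ((extChartAt 𝓘(ℝ, E) p).symm z) u) = coordsAt p _ 0 := congrArg _ h0
    rwa [coordsAt_frameAt ((extChartAt 𝓘(ℝ, E) p).map_target hz), map_zero] at this

variable {F : Type*} [NormedAddCommGroup F] [NormedSpace ℝ F]
  {N : Type*} [TopologicalSpace N] [ChartedSpace F N] [IsManifold 𝓘(ℝ, F) ∞ N]

/-- The differential of `f` in coordinate frames is the derivative of its coordinate expression. -/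
theorem mfderiv_frameAt {f : N → M} {p q : N} (hf : MDifferentiableAt 𝓘(ℝ, F) 𝓘(ℝ, E) f q)
    (hq : q ∈ (extChartAt 𝓘(ℝ, F) p).source) (hfq : f q ∈ (extChartAt 𝓘(ℝ, E) (f p)).source)
    (u : F) :
    mfderiv 𝓘(ℝ, F) 𝓘(ℝ, E) f q (frameAt p q u) =
      frameAt (f p) (f q) (fderiv ℝ (writtenInExtChartAt 𝓘(ℝ, F) 𝓘(ℝ, E) p f)
        (extChartAt 𝓘(ℝ, F) p q) u) := by
  obtain ⟨y, hy, rfl⟩ : ∃ y ∈ (extChartAt 𝓘(ℝ, F) p).target, (extChartAt 𝓘(ℝ, F) p).symm y = q :=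
    ⟨_, (extChartAt 𝓘(ℝ, F) p).map_source hq, (extChartAt 𝓘(ℝ, F) p).left_inv hq⟩
  rw [(extChartAt 𝓘(ℝ, F) p).right_inv hy]
  have h1 : HasMFDerivAt 𝓘(ℝ, F) 𝓘(ℝ, F) (extChartAt 𝓘(ℝ, F) p).symm y
      (frameAt (E := F) p ((extChartAt 𝓘(ℝ, F) p).symm y)) := by
    have h := (mdifferentiableWithinAt_extChartAt_symm (I := 𝓘(ℝ, F)) (x := p)
      hy).hasMFDerivWithinAt
    have e := TangentBundle.symmL_trivializationAt (I := 𝓘(ℝ, F)) (𝕜 := ℝ)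
      (x₀ := p) (x := (extChartAt 𝓘(ℝ, F) p).symm y) (by simpa using hq)
    rw [(extChartAt 𝓘(ℝ, F) p).right_inv hy] at e
    rw [← e] at h
    rw [modelWithCornersSelf_coe, range_id] at h
    exact hasMFDerivWithinAt_univ.1 h
  have h2 : HasMFDerivAt 𝓘(ℝ, E) 𝓘(ℝ, E) (extChartAt 𝓘(ℝ, E) (f p))
      (f ((extChartAt 𝓘(ℝ, F) p).symm y))
      (coordsAt (f p) (f ((extChartAt 𝓘(ℝ, F) p).symm y))) := by
    have hfq' : f ((extChartAt 𝓘(ℝ, F) p).symm y) ∈ (chartAt E (f p)).source := by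
      simpa using hfq
    have := (mdifferentiableAt_extChartAt (I := 𝓘(ℝ, E)) hfq').hasMFDerivAt
    rwa [← TangentBundle.continuousLinearMapAt_trivializationAt hfq'] at this
  let D : F →L[ℝ] E := (coordsAt (f p) (f ((extChartAt 𝓘(ℝ, F) p).symm y))).comp
    ((mfderiv 𝓘(ℝ, F) 𝓘(ℝ, E) f ((extChartAt 𝓘(ℝ, F) p).symm y)).comp
      (frameAt p ((extChartAt 𝓘(ℝ, F) p).symm y)))
  have h3 : HasFDerivAt (writtenInExtChartAt 𝓘(ℝ, F) 𝓘(ℝ, E) p f) D y :=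
    hasMFDerivAt_iff_hasFDerivAt.1
      (HasMFDerivAt.comp y h2 (HasMFDerivAt.comp y hf.hasMFDerivAt h1))
  have h4 : fderiv ℝ (writtenInExtChartAt 𝓘(ℝ, F) 𝓘(ℝ, E) p f) y u =
      coordsAt (f p) (f ((extChartAt 𝓘(ℝ, F) p).symm y))
        (mfderiv 𝓘(ℝ, F) 𝓘(ℝ, E) f ((extChartAt 𝓘(ℝ, F) p).symm y)
          (frameAt p ((extChartAt 𝓘(ℝ, F) p).symm y) u)) := by
    rw [h3.fderiv]
    rfl
  rw [h4, frameAt_coordsAt hfq]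

end Charts

/-! ### Second fundamental form and Gauss equation of an immersion -/

section Curvature

variable {E : Type*} [NormedAddCommGroup E] [NormedSpace ℝ E]
  {M : Type*} [TopologicalSpace M] [ChartedSpace E M] [IsManifold 𝓘(ℝ, E) ∞ M]

theorem riemann_eq_metricCoord
    (g : ∀ x : M, TangentSpace 𝓘(ℝ, E) x →L[ℝ] TangentSpace 𝓘(ℝ, E) x →L[ℝ] ℝ)
    (p : M) (X Y Z U : TangentSpace 𝓘(ℝ, E) p) :
    riemann g p X Y Z U = metricCoord g p (extChartAt 𝓘(ℝ, E) p p)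
      (curvatureCoord (metricCoord g p) (extChartAt 𝓘(ℝ, E) p p) (coordsAt p p X) (coordsAt p p Y)
        (coordsAt p p Z)) (coordsAt p p U) := by
  have hp := mem_extChartAt_source (I := 𝓘(ℝ, E)) p
  rw [metricCoord_extChartAt g hp, frameAt_coordsAt hp]
  rfl

/-- The curvature as a bilinear form in its two middle arguments. -/
def riemannMiddle (g : ∀ x : M, TangentSpace 𝓘(ℝ, E) x →L[ℝ] TangentSpace 𝓘(ℝ, E) x →L[ℝ] ℝ)
    (p : M) (X U : TangentSpace 𝓘(ℝ, E) p) :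
    TangentSpace 𝓘(ℝ, E) p →ₗ[ℝ] TangentSpace 𝓘(ℝ, E) p →ₗ[ℝ] ℝ :=
  LinearMap.mk₂ ℝ (fun Y Z => riemann g p X Y Z U)
    (fun Y Y' Z => by
      simp only [riemann_eq_metricCoord, curvatureCoord, map_add, map_sub, add_apply, sub_apply]
      ring)
    (fun r Y Z => by
      simp only [riemann_eq_metricCoord, curvatureCoord, map_add, map_sub, map_smul, add_apply,
        sub_apply, smul_apply, smul_eq_mul]
      ring)
    (fun Y Z Z' => by
      simp only [riemann_eq_metricCoord, curvatureCoord, map_add, map_sub, add_apply, sub_apply]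
      ring)
    (fun r Y Z => by
      simp only [riemann_eq_metricCoord, curvatureCoord, map_add, map_sub, map_smul, add_apply,
        sub_apply, smul_apply, smul_eq_mul]
      ring)

end Curvature

section Immersion

variable {E : Type*} [NormedAddCommGroup E] [NormedSpace ℝ E]
  {M : Type*} [TopologicalSpace M] [ChartedSpace E M] [IsManifold 𝓘(ℝ, E) ∞ M]
  {F : Type*} [NormedAddCommGroup F] [NormedSpace ℝ F]
  {N : Type*} [TopologicalSpace N] [ChartedSpace F N] [IsManifold 𝓘(ℝ, F) ∞ N]
  {g : ContMDiffRiemannianMetric 𝓘(ℝ, E) ∞ E (fun x : M => TangentSpace 𝓘(ℝ, E) x)}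
  {f : N → M} {p : N}

omit [IsManifold 𝓘(ℝ, E) ∞ M] [IsManifold 𝓘(ℝ, F) ∞ N] in
/-- Points near `extChartAt p p` come from points `q` at which both the chart around `p` and, after
applying `f`, the chart around `f p` can be used. -/
theorem eventually_exists_extChartAt (hf : Continuous f) (p : N) :
    ∀ᶠ z in 𝓝 (extChartAt 𝓘(ℝ, F) p p), ∃ q ∈ (extChartAt 𝓘(ℝ, F) p).source,
      f q ∈ (extChartAt 𝓘(ℝ, E) (f p)).source ∧ extChartAt 𝓘(ℝ, F) p q = z ∧
      writtenInExtChartAt 𝓘(ℝ, F) 𝓘(ℝ, E) p f z = extChartAt 𝓘(ℝ, E) (f p) (f q) := by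
  have h1 := continuousAt_extChartAt_symm (I := 𝓘(ℝ, F)) p
  have h2 : ∀ᶠ z in 𝓝 (extChartAt 𝓘(ℝ, F) p p),
      f ((extChartAt 𝓘(ℝ, F) p).symm z) ∈ (extChartAt 𝓘(ℝ, E) (f p)).source := by
    apply (hf.continuousAt.comp h1).eventually_mem
    simpa using chart_source_mem_nhds E (f p)
  filter_upwards [h2, extChartAt_target_mem_nhds (I := 𝓘(ℝ, F)) p] with z hz hz'
  exact ⟨_, (extChartAt 𝓘(ℝ, F) p).map_target hz', hz, (extChartAt 𝓘(ℝ, F) p).right_inv hz', rfl⟩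

omit [IsManifold 𝓘(ℝ, E) ∞ M] [IsManifold 𝓘(ℝ, F) ∞ N] in
theorem contDiffAt_writtenInExtChartAt (hf : ContMDiff 𝓘(ℝ, F) 𝓘(ℝ, E) ∞ f) (p : N) :
    ContDiffAt ℝ 3 (writtenInExtChartAt 𝓘(ℝ, F) 𝓘(ℝ, E) p f) (extChartAt 𝓘(ℝ, F) p p) := by
  have := (contMDiffAt_iff.1 (hf p)).2
  rw [modelWithCornersSelf_coe, range_id, contDiffWithinAt_univ] at this
  exact contDiffAt_infty.1 this 3

omit [IsManifold 𝓘(ℝ, E) ∞ M] [IsManifold 𝓘(ℝ, F) ∞ N] in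
theorem writtenInExtChartAt_self (f : N → M) (p : N) :
    writtenInExtChartAt 𝓘(ℝ, F) 𝓘(ℝ, E) p f (extChartAt 𝓘(ℝ, F) p p) =
      extChartAt 𝓘(ℝ, E) (f p) (f p) := by
  simp [writtenInExtChartAt]

omit [IsManifold 𝓘(ℝ, F) ∞ N] in
theorem inducedMetric_apply (p : N) (u v : TangentSpace 𝓘(ℝ, F) p) :
    inducedMetric g f p u v = g.inner (f p) (mfderiv 𝓘(ℝ, F) 𝓘(ℝ, E) f p u)
      (mfderiv 𝓘(ℝ, F) 𝓘(ℝ, E) f p v) := rfl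

theorem eventually_metricCoord_inducedMetric (hf : ContMDiff 𝓘(ℝ, F) 𝓘(ℝ, E) ∞ f) (p : N) :
    ∀ᶠ z in 𝓝 (extChartAt 𝓘(ℝ, F) p p), ∀ u v,
      metricCoord (inducedMetric (F := F) g f) p z u v =
        metricCoord g.inner (f p) (writtenInExtChartAt 𝓘(ℝ, F) 𝓘(ℝ, E) p f z)
          (fderiv ℝ (writtenInExtChartAt 𝓘(ℝ, F) 𝓘(ℝ, E) p f) z u)
          (fderiv ℝ (writtenInExtChartAt 𝓘(ℝ, F) 𝓘(ℝ, E) p f) z v) := by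
  filter_upwards [eventually_exists_extChartAt (E := E) hf.continuous p]
  rintro _ ⟨q, hq, hfq, rfl, hw⟩ u v
  rw [hw, metricCoord_extChartAt _ hq, metricCoord_extChartAt _ hfq, inducedMetric_apply,
    mfderiv_frameAt ((hf q).mdifferentiableAt (by simp)) hq hfq,
    mfderiv_frameAt ((hf q).mdifferentiableAt (by simp)) hq hfq]

theorem eventually_injective_fderiv (hf : ContMDiff 𝓘(ℝ, F) 𝓘(ℝ, E) ∞ f)
    (hi : ∀ p : N, Function.Injective (mfderiv 𝓘(ℝ, F) 𝓘(ℝ, E) f p)) (p : N) :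
    ∀ᶠ z in 𝓝 (extChartAt 𝓘(ℝ, F) p p),
      Function.Injective (fderiv ℝ (writtenInExtChartAt 𝓘(ℝ, F) 𝓘(ℝ, E) p f) z) := by
  filter_upwards [eventually_exists_extChartAt (E := E) hf.continuous p]
  rintro _ ⟨q, hq, hfq, rfl, hw⟩ u v huv
  have h1 : mfderiv 𝓘(ℝ, F) 𝓘(ℝ, E) f q (frameAt p q u) =
      mfderiv 𝓘(ℝ, F) 𝓘(ℝ, E) f q (frameAt p q v) := by
    rw [mfderiv_frameAt ((hf q).mdifferentiableAt (by simp)) hq hfq, huv,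
      mfderiv_frameAt ((hf q).mdifferentiableAt (by simp)) hq hfq]
  have h2 := congrArg (coordsAt p q) (hi q h1)
  rwa [coordsAt_frameAt hq, coordsAt_frameAt hq] at h2

theorem mfderiv_eq_frameAt (hf : ContMDiff 𝓘(ℝ, F) 𝓘(ℝ, E) ∞ f) (p : N)
    (u : TangentSpace 𝓘(ℝ, F) p) :
    mfderiv 𝓘(ℝ, F) 𝓘(ℝ, E) f p u = frameAt (f p) (f p)
      (fderiv ℝ (writtenInExtChartAt 𝓘(ℝ, F) 𝓘(ℝ, E) p f) (extChartAt 𝓘(ℝ, F) p p)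
        (coordsAt p p u)) := by
  rw [← mfderiv_frameAt ((hf p).mdifferentiableAt (by simp)) (mem_extChartAt_source p)
    (mem_extChartAt_source (f p)), frameAt_coordsAt (mem_extChartAt_source p)]

theorem coordsAt_mfderiv (hf : ContMDiff 𝓘(ℝ, F) 𝓘(ℝ, E) ∞ f) (p : N)
    (u : TangentSpace 𝓘(ℝ, F) p) :
    coordsAt (f p) (f p) (mfderiv 𝓘(ℝ, F) 𝓘(ℝ, E) f p u) =
      fderiv ℝ (writtenInExtChartAt 𝓘(ℝ, F) 𝓘(ℝ, E) p f) (extChartAt 𝓘(ℝ, F) p p)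
        (coordsAt p p u) := by
  rw [mfderiv_eq_frameAt hf, coordsAt_frameAt (mem_extChartAt_source (f p))]

theorem eventually_lagrangian
    {J : ∀ x : M, TangentSpace 𝓘(ℝ, E) x →L[ℝ] TangentSpace 𝓘(ℝ, E) x}
    (hf : IsLagrangianImmersion (F := F) g J f) (p : N) :
    ∀ᶠ z in 𝓝 (extChartAt 𝓘(ℝ, F) p p), ∀ u v,
      metricCoord g.inner (f p) (writtenInExtChartAt 𝓘(ℝ, F) 𝓘(ℝ, E) p f z)
        (endoCoord J (f p) (writtenInExtChartAt 𝓘(ℝ, F) 𝓘(ℝ, E) p f z)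
          (fderiv ℝ (writtenInExtChartAt 𝓘(ℝ, F) 𝓘(ℝ, E) p f) z u))
        (fderiv ℝ (writtenInExtChartAt 𝓘(ℝ, F) 𝓘(ℝ, E) p f) z v) = 0 := by
  filter_upwards [eventually_exists_extChartAt (E := E) hf.smooth.continuous p]
  rintro _ ⟨q, hq, hfq, rfl, hw⟩ u v
  rw [hw, metricCoord_extChartAt _ hfq, frameAt_endoCoord_extChartAt _ hfq,
    ← mfderiv_frameAt ((hf.smooth q).mdifferentiableAt (by simp)) hq hfq,
    ← mfderiv_frameAt ((hf.smooth q).mdifferentiableAt (by simp)) hq hfq]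
  exact hf.lagrangian q _ _

variable [FiniteDimensional ℝ E]

omit [IsManifold 𝓘(ℝ, F) ∞ N] in
theorem isMetricNear_ambient (g : ContMDiffRiemannianMetric 𝓘(ℝ, E) ∞ E
      (fun x : M => TangentSpace 𝓘(ℝ, E) x)) (f : N → M) (p : N) :
    IsMetricNear (metricCoord g.inner (f p))
      (writtenInExtChartAt 𝓘(ℝ, F) 𝓘(ℝ, E) p f (extChartAt 𝓘(ℝ, F) p p)) := by
  rw [writtenInExtChartAt_self]
  exact isMetricNear_metricCoord g (f p) (mem_extChartAt_target (f p))

theorem isMetricNear_induced (hf : ContMDiff 𝓘(ℝ, F) 𝓘(ℝ, E) ∞ f)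
    (hi : ∀ p : N, Function.Injective (mfderiv 𝓘(ℝ, F) 𝓘(ℝ, E) f p)) (p : N) :
    IsMetricNear (metricCoord (inducedMetric (F := F) g f) p) (extChartAt 𝓘(ℝ, F) p p) :=
  (isMetricNear_ambient g f p).of_isometry (contDiffAt_writtenInExtChartAt hf p)
    (eventually_injective_fderiv hf hi p) (eventually_metricCoord_inducedMetric hf p)

variable [FiniteDimensional ℝ F]

omit [IsManifold 𝓘(ℝ, F) ∞ N] [FiniteDimensional ℝ E] in
/-- The defining property of the tangential component. The induced metric is invertible, so
`tangentPart` is not the junk value of `ContinuousLinearMap.inverse`. -/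
theorem inducedMetric_tangentPart
    (hi : Function.Injective (mfderiv 𝓘(ℝ, F) 𝓘(ℝ, E) f p))
    (w : TangentSpace 𝓘(ℝ, E) (f p)) (v : TangentSpace 𝓘(ℝ, F) p) :
    inducedMetric g f p (tangentPart (F := F) g f p w) v =
      g.inner (f p) w (mfderiv 𝓘(ℝ, F) 𝓘(ℝ, E) f p v) := by
  -- The tangent space is identified with the normed model space `F`, where forms are invertible.
  let B : F →L[ℝ] F →L[ℝ] ℝ := inducedMetric g f p
  have hinj : Function.Injective B := by
    rw [injective_iff_map_eq_zero]
    intro u hu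
    by_contra hne
    have h1 : mfderiv 𝓘(ℝ, F) 𝓘(ℝ, E) f p u ≠ 0 := fun h => hne (hi (h.trans (map_zero _).symm))
    have h2 := g.pos (f p) _ h1
    have h3 : inducedMetric g f p u u = 0 := congrArg (fun l : F →L[ℝ] ℝ => l u) hu
    exact h2.ne' h3
  obtain ⟨e, he⟩ := exists_continuousLinearEquiv_dual hinj
  have key (l : F →L[ℝ] ℝ) : B (B.inverse l) = l := by
    rw [← he]
    simp
  exact congrArg (fun l : F →L[ℝ] ℝ => l v)
    (key ((g.inner (f p) w).comp (mfderiv 𝓘(ℝ, F) 𝓘(ℝ, E) f p)))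

theorem secondFundamentalForm_eq (hf : ContMDiff 𝓘(ℝ, F) 𝓘(ℝ, E) ∞ f)
    (hi : ∀ p : N, Function.Injective (mfderiv 𝓘(ℝ, F) 𝓘(ℝ, E) f p)) (p : N)
    (u v : TangentSpace 𝓘(ℝ, F) p) :
    secondFundamentalForm (F := F) g f p u v = frameAt (f p) (f p)
      (sffCoord (metricCoord g.inner (f p)) (metricCoord (inducedMetric (F := F) g f) p)
        (writtenInExtChartAt 𝓘(ℝ, F) 𝓘(ℝ, E) p f) (extChartAt 𝓘(ℝ, F) p p)
        (coordsAt p p u) (coordsAt p p v)) := by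
  have hp := mem_extChartAt_source (I := 𝓘(ℝ, F)) p
  have hfp := mem_extChartAt_source (I := 𝓘(ℝ, E)) (f p)
  set φ := writtenInExtChartAt 𝓘(ℝ, F) 𝓘(ℝ, E) p f with hφ
  set y := extChartAt 𝓘(ℝ, F) p p with hy
  set G := metricCoord g.inner (f p)
  set G' := metricCoord (inducedMetric (F := F) g f) p
  have hB : secondFundamentalForm (F := F) g f p u v = normalPart (F := F) g f p
    (frameAt (f p) (f p) (hessianAlong G φ y (coordsAt p p u) (coordsAt p p v))) := rfl
  have htan : tangentPart (F := F) g f p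
      (frameAt (f p) (f p) (hessianAlong G φ y (coordsAt p p u) (coordsAt p p v))) =
      frameAt p p (christoffel G' y (coordsAt p p u) (coordsAt p p v)) := by
    rw [← sub_eq_zero]
    by_contra hne
    set t := tangentPart (F := F) g f p
      (frameAt (f p) (f p) (hessianAlong G φ y (coordsAt p p u) (coordsAt p p v))) with ht
    set t' := frameAt p p (christoffel G' y (coordsAt p p u) (coordsAt p p v)) with ht'
    have heq (w : TangentSpace 𝓘(ℝ, F) p) : inducedMetric g f p t w = inducedMetric g f p t' w := by
      rw [ht, inducedMetric_tangentPart (hi p), mfderiv_eq_frameAt hf,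
        ← metricCoord_extChartAt _ hfp, ← writtenInExtChartAt_self (F := F) f p]
      rw [metric_hessianAlong_fderiv (isMetricNear_ambient g f p)
        (contDiffAt_writtenInExtChartAt hf p) (isMetricNear_induced hf hi p)
        (eventually_metricCoord_inducedMetric hf p),
        metricCoord_extChartAt _ hp, frameAt_coordsAt hp]
    have h1 : mfderiv 𝓘(ℝ, F) 𝓘(ℝ, E) f p (t - t') ≠ 0 :=
      fun h => hne (hi p (h.trans (map_zero _).symm))
    have h2 := g.pos (f p) _ h1
    have h3 (w : TangentSpace 𝓘(ℝ, F) p) : inducedMetric g f p (t - t') w = 0 := by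
      rw [map_sub, sub_apply, heq, sub_self]
    rw [← inducedMetric_apply, h3] at h2
    exact h2.false
  rw [hB, normalPart, htan, mfderiv_eq_frameAt hf, coordsAt_frameAt hp, sffCoord, map_sub]

/-- The second fundamental form as a bundled bilinear map. -/
def sffBilin (hf : ContMDiff 𝓘(ℝ, F) 𝓘(ℝ, E) ∞ f)
    (hi : ∀ p : N, Function.Injective (mfderiv 𝓘(ℝ, F) 𝓘(ℝ, E) f p)) (p : N) :
    TangentSpace 𝓘(ℝ, F) p →ₗ[ℝ] TangentSpace 𝓘(ℝ, F) p →ₗ[ℝ] TangentSpace 𝓘(ℝ, E) (f p) :=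
  LinearMap.mk₂ ℝ (fun u v => secondFundamentalForm (F := F) g f p u v)
    (fun u u' v => by
      simp only [secondFundamentalForm_eq hf hi, ← map_add]
      congr 1
      simp only [sffCoord, hessianAlong, map_add, add_apply]
      abel)
    (fun r u v => by
      simp only [secondFundamentalForm_eq hf hi, ← map_smul]
      congr 1
      simp only [sffCoord, hessianAlong, map_smul, smul_apply, smul_sub, smul_add])
    (fun u v v' => by
      simp only [secondFundamentalForm_eq hf hi, ← map_add]
      congr 1
      simp only [sffCoord, hessianAlong, map_add]
      abel)
    (fun r u v => by
      simp only [secondFundamentalForm_eq hf hi, ← map_smul]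
      congr 1
      simp only [sffCoord, hessianAlong, map_smul, smul_sub, smul_add])

/-- **Gauss equation.** -/
theorem gauss_equation (hf : ContMDiff 𝓘(ℝ, F) 𝓘(ℝ, E) ∞ f)
    (hi : ∀ p : N, Function.Injective (mfderiv 𝓘(ℝ, F) 𝓘(ℝ, E) f p)) (p : N)
    (X Y Z U : TangentSpace 𝓘(ℝ, F) p) :
    riemann (inducedMetric (F := F) g f) p X Y Z U =
      riemann g.inner (f p) (mfderiv 𝓘(ℝ, F) 𝓘(ℝ, E) f p X) (mfderiv 𝓘(ℝ, F) 𝓘(ℝ, E) f p Y)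
        (mfderiv 𝓘(ℝ, F) 𝓘(ℝ, E) f p Z) (mfderiv 𝓘(ℝ, F) 𝓘(ℝ, E) f p U)
      + g.inner (f p) (secondFundamentalForm (F := F) g f p Y Z)
          (secondFundamentalForm (F := F) g f p X U)
      - g.inner (f p) (secondFundamentalForm (F := F) g f p X Z)
          (secondFundamentalForm (F := F) g f p Y U) := by
  have hfp := mem_extChartAt_source (I := 𝓘(ℝ, E)) (f p)
  rw [riemann_eq_metricCoord, riemann_eq_metricCoord, coordsAt_mfderiv hf, coordsAt_mfderiv hf,
    coordsAt_mfderiv hf, coordsAt_mfderiv hf]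
  simp only [secondFundamentalForm_eq hf hi]
  rw [← metricCoord_extChartAt _ hfp, ← metricCoord_extChartAt _ hfp,
    ← writtenInExtChartAt_self (F := F) f p]
  exact gauss_equation_coord (isMetricNear_ambient g f p)
        (contDiffAt_writtenInExtChartAt hf p) (isMetricNear_induced hf hi p)
        (eventually_metricCoord_inducedMetric hf p) _ _ _ _

end Immersion

/-! ### Lagrangian immersions -/

section LagrangianImmersion

variable {E : Type*} [NormedAddCommGroup E] [NormedSpace ℝ E] [FiniteDimensional ℝ E]
  {M : Type*} [TopologicalSpace M] [ChartedSpace E M] [IsManifold 𝓘(ℝ, E) ∞ M]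
  {F : Type*} [NormedAddCommGroup F] [NormedSpace ℝ F] [FiniteDimensional ℝ F]
  {N : Type*} [TopologicalSpace N] [ChartedSpace F N] [IsManifold 𝓘(ℝ, F) ∞ N]
  {g : ContMDiffRiemannianMetric 𝓘(ℝ, E) ∞ E (fun x : M => TangentSpace 𝓘(ℝ, E) x)}
  {J : ∀ x : M, TangentSpace 𝓘(ℝ, E) x →L[ℝ] TangentSpace 𝓘(ℝ, E) x}
  {f : N → M}

/-- The metric as a bilinear form on the tangent space. -/
def innerForm (g : ContMDiffRiemannianMetric 𝓘(ℝ, E) ∞ E (fun x : M => TangentSpace 𝓘(ℝ, E) x))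
    (x : M) : TangentSpace 𝓘(ℝ, E) x →ₗ[ℝ] TangentSpace 𝓘(ℝ, E) x →ₗ[ℝ] ℝ :=
  LinearMap.mk₂ ℝ (fun u v => g.inner x u v) (by simp) (by simp) (by simp) (by simp)

/-- The second fundamental form of a Lagrangian immersion into a Kähler manifold is normal, and its
cubic form `g(h(u, v), J df w)` is totally symmetric. -/
theorem isLagrangianForm (hJ : IsKahler g J) (hf : IsLagrangianImmersion (F := F) g J f) (p : N) :
    IsLagrangianForm (innerForm g (f p))
      (J (f p) : TangentSpace 𝓘(ℝ, E) (f p) →ₗ[ℝ] TangentSpace 𝓘(ℝ, E) (f p))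
      (mfderiv 𝓘(ℝ, F) 𝓘(ℝ, E) f p :
        TangentSpace 𝓘(ℝ, F) p →ₗ[ℝ] TangentSpace 𝓘(ℝ, E) (f p))
      (sffBilin (g := g) hf.smooth hf.immersion p) := by
  have hfp := mem_extChartAt_source (I := 𝓘(ℝ, E)) (f p)
  have hp := mem_extChartAt_source (I := 𝓘(ℝ, F)) p
  have hG := isMetricNear_ambient (F := F) g f p
  have hφ := contDiffAt_writtenInExtChartAt hf.smooth p
  have hG' := isMetricNear_induced (g := g) hf.smooth hf.immersion p
  have hGG' := eventually_metricCoord_inducedMetric (g := g) hf.smooth p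
  have hnormal (u v w : TangentSpace 𝓘(ℝ, F) p) :
      g.inner (f p) (secondFundamentalForm (F := F) g f p u v)
        (mfderiv 𝓘(ℝ, F) 𝓘(ℝ, E) f p w) = 0 := by
    rw [secondFundamentalForm_eq hf.smooth hf.immersion, mfderiv_eq_frameAt hf.smooth,
      ← metricCoord_extChartAt _ hfp, ← writtenInExtChartAt_self (F := F) f p]
    exact metric_sffCoord_fderiv hG hφ hG' hGG' _ _ _
  have hJskew (u v : TangentSpace 𝓘(ℝ, E) (f p)) :
      g.inner (f p) (J (f p) u) v = -g.inner (f p) u (J (f p) v) := by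
    rw [← hJ.hermitian (f p) u (J (f p) v), hJ.sq_eq_neg, map_neg, neg_neg]
  refine ⟨g.symm _, g.pos _, hJ.sq_eq_neg _, hJ.hermitian _, hf.immersion p, hf.finrank_eq,
    hf.lagrangian p, ?_, hnormal, ?_⟩
  · intro u v
    change secondFundamentalForm (F := F) g f p u v = secondFundamentalForm (F := F) g f p v u
    rw [secondFundamentalForm_eq hf.smooth hf.immersion,
      secondFundamentalForm_eq hf.smooth hf.immersion, sffCoord_comm hG hφ hG']
  · have key (u v w : TangentSpace 𝓘(ℝ, F) p) :
        g.inner (f p) (secondFundamentalForm (F := F) g f p u v)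
          (J (f p) (mfderiv 𝓘(ℝ, F) 𝓘(ℝ, E) f p w)) =
        metricCoord g.inner (f p)
          (writtenInExtChartAt 𝓘(ℝ, F) 𝓘(ℝ, E) p f (extChartAt 𝓘(ℝ, F) p p))
          (hessianAlong (metricCoord g.inner (f p)) (writtenInExtChartAt 𝓘(ℝ, F) 𝓘(ℝ, E) p f)
            (extChartAt 𝓘(ℝ, F) p p) (coordsAt p p u) (coordsAt p p v))
          (endoCoord J (f p)
            (writtenInExtChartAt 𝓘(ℝ, F) 𝓘(ℝ, E) p f (extChartAt 𝓘(ℝ, F) p p))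
            (fderiv ℝ (writtenInExtChartAt 𝓘(ℝ, F) 𝓘(ℝ, E) p f) (extChartAt 𝓘(ℝ, F) p p)
              (coordsAt p p w))) := by
      have htan := mfderiv_eq_frameAt hf.smooth p (frameAt p p
        (christoffel (metricCoord (inducedMetric (F := F) g f) p) (extChartAt 𝓘(ℝ, F) p p)
          (coordsAt p p u) (coordsAt p p v)))
      rw [coordsAt_frameAt hp] at htan
      rw [writtenInExtChartAt_self, metricCoord_extChartAt _ hfp,
        frameAt_endoCoord_extChartAt _ hfp, ← mfderiv_eq_frameAt hf.smooth,
        secondFundamentalForm_eq hf.smooth hf.immersion, sffCoord, map_sub, map_sub, sub_apply,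
        sub_eq_self, ← htan, g.symm]
      exact hf.lagrangian p _ _
    intro u v w
    refine (key u v w).trans (Eq.trans ?_ (key u w v).symm)
    have htarget : writtenInExtChartAt 𝓘(ℝ, F) 𝓘(ℝ, E) p f (extChartAt 𝓘(ℝ, F) p p) ∈
        (extChartAt 𝓘(ℝ, E) (f p)).target := by
      rw [writtenInExtChartAt_self]
      exact mem_extChartAt_target (f p)
    refine metric_hessianAlong_J_symm hG hφ ?_ (hJ.parallel (f p) _ htarget) ?_
      (eventually_lagrangian hf p) _ _ _
    · exact ((contDiffOn_endoCoord hJ.smooth (f p)).contDiffAt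
        ((isOpen_extChartAt_target (f p)).mem_nhds htarget)).differentiableAt (by simp)
    · intro a b
      rw [writtenInExtChartAt_self, metricCoord_extChartAt _ hfp, metricCoord_extChartAt _ hfp,
        frameAt_endoCoord_extChartAt _ hfp, frameAt_endoCoord_extChartAt _ hfp, hJskew]

/-- The Gauss equation, traced: the Ricci curvature differs from the bound by the difference of the
two sides of the algebraic inequality for `h`. The bound contains `(n - 1) n / 4 |H|²`, which is
`(n - 1) / (4 n)` times the square of the norm of the trace of `h`. -/
theorem ricci_eq_chenRicciBound_sub_add (hn : 2 ≤ Module.finrank ℝ F)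
    (hJ : IsKahler g J) {D : ∀ x : M, Submodule ℝ (TangentSpace 𝓘(ℝ, E) x)} {a b c : M → ℝ}
    (hR : HasCurvatureCoefficients g J D a b c)
    (hf : IsLagrangianImmersion (F := F) g J f)
    (p : N) {ξ : TangentSpace 𝓘(ℝ, E) (f p)} (hξ : IsUnitNormal g D (f p) ξ)
    {n : ℝ} (hnc : n = Module.finrank ℝ F)
    {X : TangentSpace 𝓘(ℝ, F) p} (hX : inducedMetric g f p X X = 1)
    {L : TangentSpace 𝓘(ℝ, F) p →ₗ[ℝ] TangentSpace 𝓘(ℝ, E) (f p)}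
    (hL : L = (mfderiv 𝓘(ℝ, F) 𝓘(ℝ, E) f p :
        TangentSpace 𝓘(ℝ, F) p →ₗ[ℝ] TangentSpace 𝓘(ℝ, E) (f p)))
    {h : TangentSpace 𝓘(ℝ, F) p →ₗ[ℝ] TangentSpace 𝓘(ℝ, F) p →ₗ[ℝ] TangentSpace 𝓘(ℝ, E) (f p)}
    (hh : h = sffBilin (g := g) hf.smooth hf.immersion p) :
    ricci (inducedMetric g f) p X = chenRicciBound g J f p ξ (a (f p)) (b (f p)) (c (f p)) X
      - (n - 1) / (4 * n) * innerForm g (f p)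
          (IsLagrangianForm.traceForm (innerForm g (f p)) L h)
          (IsLagrangianForm.traceForm (innerForm g (f p)) L h)
      + IsLagrangianForm.extrinsicRicci (innerForm g (f p)) L h X := by
  have hn2 : (2 : ℝ) ≤ n := by rw [hnc]; exact_mod_cast hn
  have hn0 : n ≠ 0 := by linarith
  have H := isLagrangianForm hJ hf p
  rw [← hL, ← hh] at H
  have hXL : innerForm g (f p) (L X) (L X) = 1 := by rw [hL]; exact hX
  obtain ⟨e, he, -⟩ := exists_isOrthonormalFor (V := TangentSpace 𝓘(ℝ, F) p) H.induced_symm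
    H.induced_pos hXL ⟨0, by change 0 < Module.finrank ℝ F; omega⟩
  have hric : ricci (inducedMetric g f) p X =
      ∑ i, riemann (inducedMetric g f) p X (e i) (e i) X := by
    have := he.metricTrace_eq (riemannMiddle (inducedMetric g f) p X X)
    rw [hL] at this
    exact this
  have hmean : meanCurvature (F := F) g f p =
      (1 / n) • IsLagrangianForm.traceForm (innerForm g (f p)) L h := by
    rw [hnc, hL, hh]
    rfl
  have hgauss (i) : riemann (inducedMetric g f) p X (e i) (e i) X =
      (a (f p) * tensorPi (fun u v => innerForm g (f p) u v)
          (J (f p) : TangentSpace 𝓘(ℝ, E) (f p) →ₗ[ℝ] TangentSpace 𝓘(ℝ, E) (f p))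
          (L X) (L (e i)) (L (e i)) (L X)
        + b (f p) * tensorPhi (fun u v => innerForm g (f p) u v)
          (J (f p) : TangentSpace 𝓘(ℝ, E) (f p) →ₗ[ℝ] TangentSpace 𝓘(ℝ, E) (f p)) ξ
          (L X) (L (e i)) (L (e i)) (L X)
        + c (f p) * tensorPsi (fun u v => innerForm g (f p) u v)
          (J (f p) : TangentSpace 𝓘(ℝ, E) (f p) →ₗ[ℝ] TangentSpace 𝓘(ℝ, E) (f p)) ξ
          (L X) (L (e i)) (L (e i)) (L X))
      + (innerForm g (f p) (h X X) (h (e i) (e i))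
        - innerForm g (f p) (h X (e i)) (h X (e i))) := by
    rw [gauss_equation hf.smooth hf.immersion, hR (f p) ξ hξ, add_sub_assoc,
      H.g_symm (h X X)]
    conv_rhs => rw [H.h_symm X (e i)]
    conv_rhs => enter [2, 2, 1]; rw [H.h_symm (e i) X]
    rw [hL, hh]
    rfl
  rw [hric, Finset.sum_congr rfl fun i _ => hgauss i, Finset.sum_add_distrib,
    IsLagrangianForm.extrinsicRicci_eq he]
  congr 1
  set ηX := innerForm g (f p) ξ (L X)
  set ηX' := innerForm g (f p) (J (f p) ξ) (L X)
  set Y : TangentSpace 𝓘(ℝ, F) p :=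
    ηX • tangentPart g f p (J (f p) ξ) - ηX' • tangentPart g f p ξ with hYdef
  have hY (v) : innerForm g (f p) (L Y) (L v) = ηX * innerForm g (f p) (J (f p) ξ) (L v) -
      ηX' * innerForm g (f p) ξ (L v) := by
    have h1 : innerForm g (f p) (L Y) (L v) = inducedMetric g f p Y v := by rw [hL]; rfl
    rw [h1, hYdef, map_sub, map_smul, map_smul, sub_apply, smul_apply, smul_apply,
      inducedMetric_tangentPart (hf.immersion p), inducedMetric_tangentPart (hf.immersion p), hL]
    rfl
  refine (H.sum_curvature_eq he (by simp) (n := n) (by rw [Fintype.card_fin]; exact hnc) hξ.1 hXL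
    hY _ _ _).trans ?_
  change (n - 1) / 4 * a (f p) + 1 / 8 * ((n - 2) * (ηX ^ 2 + ηX' ^ 2) + 1) * b (f p)
    + innerForm g (f p) (L Y) (L Y) * c (f p) = _
  have hbound : chenRicciBound g J f p ξ (a (f p)) (b (f p)) (c (f p)) X =
      (n - 1) / 4 * a (f p) + 1 / 8 * ((n - 2) * (ηX ^ 2 + ηX' ^ 2) + 1) * b (f p)
      + innerForm g (f p) (L Y) (L Y) * c (f p) + (n - 1) * n / 4 *
        innerForm g (f p) (meanCurvature (F := F) g f p) (meanCurvature (F := F) g f p) := by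
    rw [hnc]
    simp only [ηX, ηX', hYdef, hL]
    rfl
  rw [hbound, hmean]
  simp only [map_smul, LinearMap.smul_apply, smul_eq_mul]
  field_simp
  ring

end LagrangianImmersion

end

end QCH

theorem theorem4p1
    {E : Type*} [NormedAddCommGroup E] [NormedSpace ℝ E] [FiniteDimensional ℝ E]
    {M : Type*} [TopologicalSpace M] [ChartedSpace E M] [IsManifold 𝓘(ℝ, E) ∞ M]
    {F : Type*} [NormedAddCommGroup F] [NormedSpace ℝ F] [FiniteDimensional ℝ F]
    {N : Type*} [TopologicalSpace N] [ChartedSpace F N] [IsManifold 𝓘(ℝ, F) ∞ N]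
    (hn : 2 ≤ Module.finrank ℝ F)
    (g : ContMDiffRiemannianMetric 𝓘(ℝ, E) ∞ E (fun x : M => TangentSpace 𝓘(ℝ, E) x))
    (J : ∀ x : M, TangentSpace 𝓘(ℝ, E) x →L[ℝ] TangentSpace 𝓘(ℝ, E) x)
    (hJ : QCH.IsKahler g J)
    (D : ∀ x : M, Submodule ℝ (TangentSpace 𝓘(ℝ, E) x))
    (hD : QCH.IsInvariantDistribution g J D)
    (hQ : QCH.IsQuasiConstant g J D)
    (a b c : M → ℝ) (hR : QCH.HasCurvatureCoefficients g J D a b c)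
    (f : N → M) (hf : QCH.IsLagrangianImmersion (F := F) g J f)
    (p : N) (ξ : TangentSpace 𝓘(ℝ, E) (f p)) (hξ : QCH.IsUnitNormal g D (f p) ξ) :
    (∀ X : TangentSpace 𝓘(ℝ, F) p, QCH.inducedMetric g f p X X = 1 →
      QCH.ricci (QCH.inducedMetric g f) p X ≤
        QCH.chenRicciBound g J f p ξ (a (f p)) (b (f p)) (c (f p)) X) ∧
    ((∀ X : TangentSpace 𝓘(ℝ, F) p, QCH.inducedMetric g f p X X = 1 →
      QCH.ricci (QCH.inducedMetric g f) p X =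
        QCH.chenRicciBound g J f p ξ (a (f p)) (b (f p)) (c (f p)) X) ↔
      (QCH.IsTotallyGeodesicAt (F := F) g f p ∨
        (Module.finrank ℝ F = 2 ∧ ∃ lam mu : ℝ,
          QCH.IsHUmbilicalAt (F := F) g J f p lam mu ∧ lam = 3 * mu))) := by
  have H := QCH.isLagrangianForm hJ hf p
  have hric (X : TangentSpace 𝓘(ℝ, F) p) (hX : QCH.inducedMetric g f p X X = 1) :=
    QCH.ricci_eq_chenRicciBound_sub_add hn hJ hR hf p hξ rfl hX rfl rfl
  have hn' : 2 ≤ Module.finrank ℝ (TangentSpace 𝓘(ℝ, F) p) := hn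
  refine ⟨fun X hX => ?_, fun heq => ?_, ?_⟩
  · have h1 := H.extrinsicRicci_le hn' (n := Module.finrank ℝ F) rfl hX
    rw [hric X hX]
    linarith
  · have heq' (X : TangentSpace 𝓘(ℝ, F) p) (hX : QCH.inducedMetric g f p X X = 1) := by
      have h1 := heq X hX
      rw [hric X hX, sub_add, sub_eq_self, sub_eq_zero] at h1
      exact h1.symm
    rcases hn'.lt_or_eq with hlt | h2
    · exact Or.inl (H.eq_zero_of_extrinsicRicci_eq hlt rfl heq')
    · exact Or.inr ⟨h2.symm, H.isHUmbilical_of_extrinsicRicci_eq h2.symm rfl heq'⟩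
  · rintro (h0 | ⟨h2, lam, mu, hu, rfl⟩) X hX
    · have hz : QCH.sffBilin (g := g) hf.smooth hf.immersion p = 0 := by
        ext u v
        exact h0 u v
      rw [hric X hX, hz]
      obtain ⟨e, he, -⟩ := QCH.exists_isOrthonormalFor (V := TangentSpace 𝓘(ℝ, F) p)
        H.induced_symm H.induced_pos hX ⟨0, by omega⟩
      rw [QCH.IsLagrangianForm.extrinsicRicci_eq he, QCH.IsLagrangianForm.traceForm_eq he]
      simp
    · rw [hric X hX, sub_add, sub_eq_self, sub_eq_zero]
      exact (H.extrinsicRicci_eq_of_isHUmbilical h2 rfl hu hX).symm
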